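/- Let $(\mathcal G,\mu)$ be a (non-singular) discrete measured groupoid: $\mathcal G$ is a groupoid that is a standard Borel space, with Borel unit space $\mathcal G^{(0)}$, countable-to-one Borel source and target maps $s,t$, and Borel composition and inversion, and $\mu$ is a probability measure on $\mathcal G^{(0)}$ such that the measures $\mu_s(A)=\int |A\cap s^{-1}(x)|\,d\mu(x)$ and $\mu_t(A)=\int |A\cap t^{-1}(x)|\,d\mu(x)$ on $\mathcal G$ are equivalent. Let $\omega$ be a Borel $2$-cocycle on $\mathcal G$ with values in $\mathbb T$, that is, $\omega(x,yz)\omega(y,z)=\omega(xy,z)\omega(x,y)$ for composable $x,y,z$, which is normalized by $\omega(x,s(x))=\omega(t(x),x)=\omega(x,x^{-1})=1$ for all $x$. A Borel bisection is a Borel set $A\subset\mathcal G$ on which $s$ and $t$ are injective. For a Borel bisection $A$, let $\lambda_A^\omega$ be the bounded operator on $L^2(\mathcal G,\mu_s)$ such that, for every Borel $E$ with $\mu_s(E)<\infty$, the function $\lambda^\omega_A1_E$ equals $\omega(a,e)$ at $ae$ for composable $a\in A$, $e\in E$ and vanishes off $A\cdot E$; and let $\rho_A^\omega$ be the operator such that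 $\rho^\omega_A1_E$ equals $\overline{\omega(e,b)}$ at $eb$ for composable $e\in E$, $b\in A^{-1}$ and vanishes off $E\cdot A^{-1}$. The operator $\rho_A^\omega$ is considered for those $A$ for which this formula defines a bounded operator on $L^2(\mathcal G,\mu_s)$, i.e. for which there is $c<\infty$ with $\mu_s(E\cdot A^{-1})\le c\,\mu_s(E)$ for all Borel $E$ (every $A$, if $\mu_s=\mu_t$). Set $$L_\omega(\mathcal G)=\{\lambda_A^\omega\}'',\qquad R_\omega(\mathcal G)=\{\rho_A^\omega\}''.$$ For functions $f,g$ let $(f*_\omega g)(x)=\sum_{ab=x}\omega(a,b)f(a)g(b)$. A function $f\in L^2(\mathcal G,\mu_s)$ is a left (respectively right) convolver for $\omega$ if for every $g\in L^2(\mathcal G,\mu_s)$ the series defining $f*_\omega g$ (respectively $g*_{\overline\omega}f$) converges absolutely $\mu_s$-almost everywhere and its sum lies in $L^2(\mathcal G,\mu_s)$. Let $LC_\omega(\mathcal G)$ be the set of the operators $L_f^\omega\colon g\mapsto f*_\omega g$ for left convolvers $f$, and $RC_\omega(\mathcal G)$ the set of the operators $R_f^\omega\colon g\mapsto g*_{\overline\omega}f$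 for right convolvers $f$. Then the operators $\lambda_A^\omega$, $\rho_A^{\overline\omega}$ (for $A$ as described), $L_f^\omega$ and $R_f^{\overline\omega}$ are well defined and bounded, and $$L_\omega(\mathcal G)=LC_\omega(\mathcal G)=R_{\overline\omega}(\mathcal G)',\qquad R_{\overline\omega}(\mathcal G)=RC_{\overline\omega}(\mathcal G)=L_\omega(\mathcal G)'.$$ -/

import Mathlib

open MeasureTheory
open scoped ENNReal NNReal

/-- A discrete Borel groupoid on a measurable space `G` of arrows (assumed standard Borel in the
theorem). Units are identified with identity arrows, so source and target are maps `G → G`.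
The value `mul g h` is meaningful only if `src g = tgt h`; no law constrains it otherwise. -/
structure DiscreteBorelGroupoid (G : Type*) [MeasurableSpace G] where
  src : G → G
  tgt : G → G
  mul : G → G → G
  inv : G → G
  src_src : ∀ g, src (src g) = src g
  tgt_src : ∀ g, tgt (src g) = src g
  src_tgt : ∀ g, src (tgt g) = tgt g
  tgt_tgt : ∀ g, tgt (tgt g) = tgt g
  src_mul : ∀ g h, src g = tgt h → src (mul g h) = src h
  tgt_mul : ∀ g h, src g = tgt h → tgt (mul g h) = tgt g
  mul_assoc : ∀ g h k, src g = tgt h → src h = tgt k → mul (mul g h) k = mul g (mul h k)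
  tgt_mul_self : ∀ g, mul (tgt g) g = g
  mul_src_self : ∀ g, mul g (src g) = g
  src_inv : ∀ g, src (inv g) = tgt g
  tgt_inv : ∀ g, tgt (inv g) = src g
  mul_inv : ∀ g, mul g (inv g) = tgt g
  inv_mul : ∀ g, mul (inv g) g = src g
  measurableSet_units : MeasurableSet {g | src g = g}
  measurable_src : Measurable src
  measurable_tgt : Measurable tgt
  countable_src_fiber : ∀ x, (src ⁻¹' {x}).Countable
  countable_tgt_fiber : ∀ x, (tgt ⁻¹' {x}).Countable
  measurable_mul :
    Measurable (fun p : {p : G × G // src p.1 = tgt p.2} => mul p.1.1 p.1.2)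
  measurable_inv : Measurable inv

namespace DiscreteBorelGroupoid

noncomputable section

variable {G : Type*} [MeasurableSpace G] (𝒢 : DiscreteBorelGroupoid G)

/-- The unit space. -/
def units : Set G := {g | 𝒢.src g = g}

/-- The product `A · B` of two sets of arrows. -/
def setMul (A B : Set G) : Set G :=
  {g | ∃ a ∈ A, ∃ b ∈ B, 𝒢.src a = 𝒢.tgt b ∧ 𝒢.mul a b = g}

/-- The set `A⁻¹` of inverses of the elements of `A`. -/
def setInv (A : Set G) : Set G := 𝒢.inv '' A

/-- Borel (partial) bisections. -/
structure IsBorelBisection (A : Set G) : Prop where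
  measurableSet : MeasurableSet A
  injOn_src : Set.InjOn 𝒢.src A
  injOn_tgt : Set.InjOn 𝒢.tgt A

/-- The measure `μ_s(A) = ∫ |{g ∈ A | s(g) = x}| dμ(x)`. (The integrand is Borel in `x` since `s`
is a countable-to-one Borel map on a standard Borel space.) -/
def muS (μ : Measure G) : Measure G :=
  μ.bind fun x => Measure.count.restrict (𝒢.src ⁻¹' {x})

/-- The measure `μ_t(A) = ∫ |{g ∈ A | t(g) = x}| dμ(x)`. -/
def muT (μ : Measure G) : Measure G :=
  μ.bind fun x => Measure.count.restrict (𝒢.tgt ⁻¹' {x})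

/-- `(𝒢, μ)` is a (non-singular) discrete measured groupoid: `μ` is a probability measure on the
unit space (regarded as a measure on `G` concentrated on the units), and `μ_s`, `μ_t` are
equivalent. -/
structure IsMeasured (μ : Measure G) : Prop where
  isProbabilityMeasure : IsProbabilityMeasure μ
  units_compl : μ 𝒢.unitsᶜ = 0
  muS_ac_muT : 𝒢.muS μ ≪ 𝒢.muT μ
  muT_ac_muS : 𝒢.muT μ ≪ 𝒢.muS μ

/-- Circle-valued Borel 2-cocycles, normalized and with `ω(x, x⁻¹) = 1`. Only the values on
composable pairs are meaningful. -/
structure Cocycle where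
  toFun : G → G → Circle
  measurable_toFun :
    Measurable (fun p : {p : G × G // 𝒢.src p.1 = 𝒢.tgt p.2} => (toFun p.1.1 p.1.2 : ℂ))
  cocycle : ∀ x y z, 𝒢.src x = 𝒢.tgt y → 𝒢.src y = 𝒢.tgt z →
    toFun x (𝒢.mul y z) * toFun y z = toFun (𝒢.mul x y) z * toFun x y
  map_src : ∀ x, toFun x (𝒢.src x) = 1
  map_tgt : ∀ x, toFun (𝒢.tgt x) x = 1
  map_inv : ∀ x, toFun x (𝒢.inv x) = 1

variable {𝒢}

/-- The complex conjugate cocycle; on `Circle`, inversion is complex conjugation. -/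
def Cocycle.conj (ω : 𝒢.Cocycle) : 𝒢.Cocycle where
  toFun x y := (ω.toFun x y)⁻¹
  measurable_toFun := by
    simp only [Circle.coe_inv]
    exact ω.measurable_toFun.inv
  cocycle x y z hxy hyz := by
    rw [← _root_.mul_inv, ← _root_.mul_inv, ω.cocycle x y z hxy hyz]
  map_src x := by rw [ω.map_src, inv_one]
  map_tgt x := by rw [ω.map_tgt, inv_one]
  map_inv x := by rw [ω.map_inv, inv_one]

variable (𝒢) in
/-- The Hilbert space `L²(𝒢, μ_s)`. -/
abbrev L2 (μ : Measure G) : Type _ := Lp ℂ 2 (𝒢.muS μ)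

/-- `T` is the operator `λ_A^ω`: for all Borel `E` of finite measure, `T 1_E` takes the value
`ω(a, e)` at `g = a e` with `a ∈ A`, `e ∈ E`, and vanishes outside `A · E`. -/
def IsLeftTranslation (μ : Measure G) (ω : 𝒢.Cocycle) (A : Set G)
    (T : 𝒢.L2 μ →L[ℂ] 𝒢.L2 μ) : Prop :=
  ∀ (E : Set G) (hE : MeasurableSet E) (hfin : 𝒢.muS μ E ≠ ∞), ∀ᵐ g ∂(𝒢.muS μ),
    (∀ a ∈ A, ∀ e ∈ E, 𝒢.src a = 𝒢.tgt e → 𝒢.mul a e = g →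
      T (indicatorConstLp 2 hE hfin 1) g = (ω.toFun a e : ℂ)) ∧
    (g ∉ 𝒢.setMul A E → T (indicatorConstLp 2 hE hfin 1) g = 0)

/-- `T` is the operator `ρ_A^ω`: for all Borel `E` of finite measure, `T 1_E` takes the value
`conj (ω(e, b))` at `g = e b` with `e ∈ E`, `b ∈ A⁻¹`, and vanishes outside `E · A⁻¹`.
If `μ` is not invariant, such a bounded operator exists precisely for those bisections `A` for
which `μ_s(E · A⁻¹)` is bounded by a constant multiple of `μ_s(E)`. -/
def IsRightTranslation (μ : Measure G) (ω : 𝒢.Cocycle) (A : Set G)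
    (T : 𝒢.L2 μ →L[ℂ] 𝒢.L2 μ) : Prop :=
  ∀ (E : Set G) (hE : MeasurableSet E) (hfin : 𝒢.muS μ E ≠ ∞), ∀ᵐ g ∂(𝒢.muS μ),
    (∀ b ∈ 𝒢.setInv A, ∀ e ∈ E, 𝒢.src e = 𝒢.tgt b → 𝒢.mul e b = g →
      T (indicatorConstLp 2 hE hfin 1) g = star (ω.toFun e b : ℂ)) ∧
    (g ∉ 𝒢.setMul E (𝒢.setInv A) → T (indicatorConstLp 2 hE hfin 1) g = 0)

/-- The left twisted groupoid von Neumann algebra `L_ω(𝒢) = {λ_A^ω}''`. -/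
def leftVN (μ : Measure G) (ω : 𝒢.Cocycle) : Set (𝒢.L2 μ →L[ℂ] 𝒢.L2 μ) :=
  Set.centralizer (Set.centralizer
    {T | ∃ A, 𝒢.IsBorelBisection A ∧ IsLeftTranslation μ ω A T})

/-- The right twisted groupoid von Neumann algebra `R_ω(𝒢) = {ρ_A^ω}''`, generated by all the
`ρ_A^ω` that are bounded operators. -/
def rightVN (μ : Measure G) (ω : 𝒢.Cocycle) : Set (𝒢.L2 μ →L[ℂ] 𝒢.L2 μ) :=
  Set.centralizer (Set.centralizer
    {T | ∃ A, 𝒢.IsBorelBisection A ∧ IsRightTranslation μ ω A T})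

variable (𝒢) in
/-- The pairs `(a, b)` of composable arrows with `a b = x`. -/
def factorizations (x : G) : Set (G × G) :=
  {p | 𝒢.src p.1 = 𝒢.tgt p.2 ∧ 𝒢.mul p.1 p.2 = x}

/-- The twisted convolution `(f *_ω g)(x) = ∑_{ab = x} ω(a, b) f(a) g(b)`. -/
def conv (ω : 𝒢.Cocycle) (f g : G → ℂ) (x : G) : ℂ :=
  ∑' p : 𝒢.factorizations x, (ω.toFun p.1.1 p.1.2 : ℂ) * f p.1.1 * g p.1.2

/-- `f *_ω g` is a well-defined element of `L²(𝒢, μ_s)`: the defining series converges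
(absolutely) almost everywhere, and its sum is square integrable. -/
def ConvMemL2 (μ : Measure G) (ω : 𝒢.Cocycle) (f g : G → ℂ) : Prop :=
  (∀ᵐ x ∂(𝒢.muS μ), Summable fun p : 𝒢.factorizations x =>
    (ω.toFun p.1.1 p.1.2 : ℂ) * f p.1.1 * g p.1.2) ∧
  MemLp (conv ω f g) 2 (𝒢.muS μ)

/-- Left convolvers for `(𝒢, ω)`. -/
def IsLeftConvolver (μ : Measure G) (ω : 𝒢.Cocycle) (f : 𝒢.L2 μ) : Prop :=
  ∀ g : 𝒢.L2 μ, ConvMemL2 μ ω f g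

/-- Right convolvers for `(𝒢, ω)`. As in the definition of `ρ^ω`, the right-handed objects
attached to `ω` involve the conjugate of `ω`. -/
def IsRightConvolver (μ : Measure G) (ω : 𝒢.Cocycle) (f : 𝒢.L2 μ) : Prop :=
  ∀ g : 𝒢.L2 μ, ConvMemL2 μ ω.conj g f

/-- `T` is the operator `L_f^ω : g ↦ f *_ω g`. -/
def IsLeftConv (μ : Measure G) (ω : 𝒢.Cocycle) (f : 𝒢.L2 μ)
    (T : 𝒢.L2 μ →L[ℂ] 𝒢.L2 μ) : Prop :=
  ∀ g : 𝒢.L2 μ, T g =ᵐ[𝒢.muS μ] conv ω f g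

/-- `T` is the operator `R_f^ω : g ↦ g *_{conj ω} f`. -/
def IsRightConv (μ : Measure G) (ω : 𝒢.Cocycle) (f : 𝒢.L2 μ)
    (T : 𝒢.L2 μ →L[ℂ] 𝒢.L2 μ) : Prop :=
  ∀ g : 𝒢.L2 μ, T g =ᵐ[𝒢.muS μ] conv ω.conj g f

/-- The set `LC_ω(𝒢)` of all `L_f^ω`, for left convolvers `f`. -/
def leftConvolvers (μ : Measure G) (ω : 𝒢.Cocycle) : Set (𝒢.L2 μ →L[ℂ] 𝒢.L2 μ) :=
  {T | ∃ f : 𝒢.L2 μ, IsLeftConvolver μ ω f ∧ IsLeftConv μ ω f T}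

/-- The set `RC_ω(𝒢)` of all `R_f^ω`, for right convolvers `f`. -/
def rightConvolvers (μ : Measure G) (ω : 𝒢.Cocycle) : Set (𝒢.L2 μ →L[ℂ] 𝒢.L2 μ) :=
  {T | ∃ f : 𝒢.L2 μ, IsRightConvolver μ ω f ∧ IsRightConv μ ω f T}

end

end DiscreteBorelGroupoid

/-!
Up to null sets `𝒢` is a countable union of Borel bisections; this is the Lusin–Novikov theorem, of
which an almost everywhere version suffices. On a fixed fibre of the source map `f *_ω g` is a sum
over that fibre, so for a convolver `f` the operator `g ↦ f *_ω g` is bounded by the closed graph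
theorem. Left and right convolutions commute: this needs to be checked only on indicator functions
`1_E` of bisections, where associativity holds pointwise because `(f * 1_E) * h` and `f * (1_E * h)`
are the same sum.

Conversely, let `T` commute with all `λ_A^ω` and let `ξ` be the indicator function of the units.
Then `T 1_E = T λ_E^ω ξ = λ_E^ω (T ξ) = 1_E *_ω T ξ` for every bisection `E`, so `T` is right
convolution by `T ξ` on a dense subspace. That the series `g *_ω T ξ` converges absolutely for
every `g` is seen by passing to the limit over finite unions of bisections, after multiplying `g`
by a phase which makes all its terms nonnegative. For the other side one uses that almost all of a
bisection is covered by pieces on which the Radon–Nikodym derivative comparing `μ_s` with `μ_t` is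
bounded, so that the corresponding right translations are bounded operators.
-/

open Set Filter Topology

section AnalyticSets

theorem exists_lt_measure_image_inter_le {X Y : Type*} [MeasurableSpace Y] {f : X → Y}
    {μ : Measure Y} {A : Set X} {r : ℝ≥0∞} (hr : r < μ (f '' A)) (N : X → ℕ) :
    ∃ m, r < μ (f '' (A ∩ {x | N x ≤ m})) := by
  have hmono : Monotone fun m => f '' (A ∩ {x | N x ≤ m}) := fun m n hmn =>
    image_mono (inter_subset_inter_right A fun x (hx : N x ≤ m) => hx.trans hmn)
  have hunion : f '' A = ⋃ m, f '' (A ∩ {x | N x ≤ m}) := by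
    rw [← image_iUnion, ← inter_iUnion, iUnion_eq_univ_iff.2 fun x => ⟨N x, le_refl (N x)⟩,
      inter_univ]
  rwa [hunion, hmono.measure_iUnion, lt_iSup_iff] at hr

theorem exists_forall_lt_measure_image_pi_Iic {Y : Type*} [MeasurableSpace Y] {f : (ℕ → ℕ) → Y}
    {μ : Measure Y} {r : ℝ≥0∞} (hr : r < μ (range f)) :
    ∃ k : ℕ → ℕ, ∀ n, r < μ (f '' (Iio n).pi fun i => Iic (k i)) := by
  have hstep : ∀ (n : ℕ) (A : Set (ℕ → ℕ)), ∃ m, r < μ (f '' A) →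
      r < μ (f '' (A ∩ {σ | σ n ≤ m})) := fun n A => by
    by_cases hA : r < μ (f '' A)
    · exact (exists_lt_measure_image_inter_le hA fun σ => σ n).imp fun m hm _ => hm
    · exact ⟨0, fun h => absurd h hA⟩
  choose m hm using hstep
  let S : ℕ → Set (ℕ → ℕ) := fun n => n.rec univ fun j A => A ∩ {σ | σ j ≤ m j A}
  have hS : ∀ n, S n = (Iio n).pi fun i => Iic (m i (S i)) := fun n => by
    induction n with
    | zero => simp [S]
    | succ n ih =>
      rw [← Order.succ_eq_add_one, Order.Iio_succ_eq_insert, insert_pi, ← ih, inter_comm]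
      rfl
  refine ⟨fun i => m i (S i), fun n => hS n ▸ ?_⟩
  induction n with
  | zero => rwa [← image_univ] at hr
  | succ n ih => exact hm n _ ih

theorem exists_pi_Iio_subset_of_isOpen {k : ℕ → ℕ} {W : Set (ℕ → ℕ)} (hW : IsOpen W)
    (hk : (univ.pi fun i => Iic (k i)) ⊆ W) : ∃ n, ((Iio n).pi fun i => Iic (k i)) ⊆ W := by
  by_contra! hcon
  choose σ hσk hσW using fun n => not_subset.1 (hcon n)
  have hcompact : IsCompact (univ.pi fun i => Iic (k i)) :=
    isCompact_univ_pi fun i => (finite_Iic (k i)).isCompact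
  obtain ⟨x, hx, φ, hφ, hlim⟩ := hcompact.tendsto_subseq (x := fun n i => min (σ n i) (k i))
    fun n i _ => mem_Iic.2 (min_le_right _ _)
  have hlim' : Tendsto (σ ∘ φ) atTop (𝓝 x) := by
    rw [tendsto_pi_nhds] at hlim ⊢
    intro i
    refine (hlim i).congr' ?_
    filter_upwards [eventually_gt_atTop i] with j hj
    exact min_eq_left (hσk (φ j) i (hj.trans_le hφ.le_apply))
  obtain ⟨j, hj⟩ := (hlim'.eventually (hW.mem_nhds (hk hx))).exists
  exact hσW _ hj

theorem exists_isCompact_subset_range_le_measure {Y : Type*} [TopologicalSpace Y]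
    [MeasurableSpace Y] {μ : Measure Y} [μ.OuterRegular] {f : (ℕ → ℕ) → Y} (hf : Continuous f)
    {r : ℝ≥0∞} (hr : r < μ (range f)) : ∃ K ⊆ range f, IsCompact K ∧ r ≤ μ K := by
  obtain ⟨k, hk⟩ := exists_forall_lt_measure_image_pi_Iic hr
  have hcompact : IsCompact (univ.pi fun i => Iic (k i)) :=
    isCompact_univ_pi fun i => (finite_Iic (k i)).isCompact
  refine ⟨f '' univ.pi fun i => Iic (k i), image_subset_range _ _, hcompact.image hf, ?_⟩
  rw [measure_eq_iInf_isOpen]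
  refine le_iInf₂ fun O hO => le_iInf fun hOopen => ?_
  obtain ⟨n, hn⟩ := exists_pi_Iio_subset_of_isOpen (hOopen.preimage hf) (image_subset_iff.1 hO)
  exact (hk n).le.trans (measure_mono (image_subset_iff.2 hn))

theorem nullMeasurableSet_range_of_continuous {Y : Type*} [TopologicalSpace Y] [T2Space Y]
    [MeasurableSpace Y] [OpensMeasurableSpace Y] {μ : Measure Y} [μ.OuterRegular]
    [IsFiniteMeasure μ] {f : (ℕ → ℕ) → Y} (hf : Continuous f) :
    NullMeasurableSet (range f) μ := by
  rcases eq_or_ne (μ (range f)) 0 with hzero | hzero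
  · exact .of_null hzero
  obtain ⟨r, -, hr, hlim⟩ := exists_seq_strictMono_tendsto' (pos_iff_ne_zero.2 hzero)
  choose K hKsub hKcompact hKr using
    fun n => exists_isCompact_subset_range_le_measure hf (hr n).2
  have hmeas : NullMeasurableSet (⋃ n, K n) μ :=
    .iUnion fun n => (hKcompact n).measurableSet.nullMeasurableSet
  have hle : μ (range f) ≤ μ (⋃ n, K n) :=
    le_of_tendsto' hlim fun n => (hKr n).trans (measure_mono (subset_iUnion K n))
  exact hmeas.congr
    (ae_eq_of_subset_of_measure_ge (iUnion_subset hKsub) hle hmeas (measure_ne_top _ _))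

theorem nullMeasurableSet_of_analyticSet {Y : Type*} [TopologicalSpace Y] [PolishSpace Y]
    [MeasurableSpace Y] [BorelSpace Y] {A : Set Y} (hA : AnalyticSet A) (μ : Measure Y)
    [SFinite μ] : NullMeasurableSet A μ := by
  refine NullMeasurableSet.mono_ac ?_ (absolutelyContinuous_toFinite μ)
  rw [AnalyticSet] at hA
  rcases hA with rfl | ⟨f, hf, rfl⟩
  · exact nullMeasurableSet_empty
  · exact nullMeasurableSet_range_of_continuous hf

end AnalyticSets

section LusinNovikov

/-- Countably many measurable sets on which `f` is injective cover the part of `A` over `μ`-almost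
every point. -/
def AESigmaInjOn {X Y : Type*} [MeasurableSpace X] [MeasurableSpace Y] (f : X → Y) (μ : Measure Y)
    (A : Set X) : Prop :=
  ∃ 𝒮 : Set (Set X), 𝒮.Countable ∧ (∀ S ∈ 𝒮, MeasurableSet S ∧ InjOn f S) ∧
    ∀ᵐ y ∂μ, A ∩ f ⁻¹' {y} ⊆ ⋃₀ 𝒮

namespace AESigmaInjOn

variable {X Y : Type*} [MeasurableSpace X] [MeasurableSpace Y] {f : X → Y} {μ : Measure Y}

theorem mono {A B : Set X} (h : AESigmaInjOn f μ B) (hAB : A ⊆ B) : AESigmaInjOn f μ A := by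
  obtain ⟨𝒮, hcount, h𝒮, hcover⟩ := h
  exact ⟨𝒮, hcount, h𝒮, hcover.mono fun y hy => (inter_subset_inter_left _ hAB).trans hy⟩

theorem iUnion {ι : Type*} [Countable ι] {A : ι → Set X} (h : ∀ i, AESigmaInjOn f μ (A i)) :
    AESigmaInjOn f μ (⋃ i, A i) := by
  choose 𝒮 hcount h𝒮 hcover using h
  refine ⟨⋃ i, 𝒮 i, countable_iUnion hcount, fun S hS => ?_, ?_⟩
  · obtain ⟨i, hi⟩ := mem_iUnion.1 hS
    exact h𝒮 i S hi
  · filter_upwards [ae_all_iff.2 hcover] with y hy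
    rw [iUnion_inter, sUnion_iUnion]
    exact iUnion_mono hy

theorem union {A B : Set X} (hA : AESigmaInjOn f μ A) (hB : AESigmaInjOn f μ B) :
    AESigmaInjOn f μ (A ∪ B) := by
  rw [union_eq_iUnion]
  exact iUnion fun b => by cases b <;> assumption

theorem of_injOn {A : Set X} (hA : MeasurableSet A) (hf : InjOn f A) : AESigmaInjOn f μ A :=
  ⟨{A}, countable_singleton A, fun S hS => by rw [mem_singleton_iff.1 hS]; exact ⟨hA, hf⟩,
    .of_forall fun y => by rw [sUnion_singleton]; exact inter_subset_left⟩

theorem of_ae_fiber_eq_empty {A : Set X} (h : ∀ᵐ y ∂μ, A ∩ f ⁻¹' {y} = ∅) : AESigmaInjOn f μ A :=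
  ⟨∅, countable_empty, fun _ hS => hS.elim, h.mono fun _ hy => hy ▸ empty_subset _⟩

theorem exists_pairwise_disjoint (h : AESigmaInjOn f μ univ) :
    ∃ S : ℕ → Set X, (∀ n, MeasurableSet (S n) ∧ InjOn f (S n)) ∧
      Pairwise (Function.onFun Disjoint S) ∧ ∀ᵐ y ∂μ, f ⁻¹' {y} ⊆ ⋃ n, S n := by
  obtain ⟨𝒮, hcount, h𝒮, hcover⟩ := h
  obtain ⟨S, hS⟩ := (hcount.insert ∅).exists_eq_range (insert_nonempty _ _)
  have hSn : ∀ n, MeasurableSet (S n) ∧ InjOn f (S n) := fun n => by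
    rcases hS ▸ mem_range_self n with hn | hn
    · rw [hn]; exact ⟨.empty, injOn_empty _⟩
    · exact h𝒮 _ hn
  refine ⟨disjointed S, fun n => ⟨.disjointed (fun n => (hSn n).1) n,
    (hSn n).2.mono (disjointed_subset S n)⟩, disjoint_disjointed S, ?_⟩
  rw [iUnion_disjointed, ← sUnion_range, ← hS, sUnion_insert, empty_union]
  simpa only [univ_inter] using hcover

end AESigmaInjOn

theorem exists_isOpen_inter_eq_singleton_of_countable {X : Type*} [TopologicalSpace X]
    [PolishSpace X] {C : Set X} (hC : IsClosed C) (hcount : C.Countable) (hne : C.Nonempty) :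
    ∃ x ∈ C, ∃ U, IsOpen U ∧ U ∩ C = {x} := by
  have := hC.polishSpace
  have := hcount.to_subtype
  have := hne.to_subtype
  obtain ⟨x, hx⟩ := nonempty_interior_of_iUnion_of_closed (f := fun x : C => {x})
    (fun x => isClosed_singleton) (iUnion_of_singleton C)
  have hopen : IsOpen {x} :=
    interior_eq_iff_isOpen.1 (hx.subset_singleton_iff.1 interior_subset)
  obtain ⟨U, hU, hUx⟩ := isOpen_induced_iff.1 hopen
  refine ⟨x, x.2, U, hU, ?_⟩
  rw [inter_comm, ← Subtype.image_preimage_coe, hUx, image_singleton]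

theorem exists_forall_le_of_iInter_mem {X ι : Type*} [Countable ι] {𝓕 : Set (Set X)}
    (hne : 𝓕.Nonempty) (hinter : ∀ F : ℕ → Set X, (∀ n, F n ∈ 𝓕) → ⋂ n, F n ∈ 𝓕)
    {φ : ι → Set X → ℝ≥0∞} (hφ : ∀ i, Monotone (φ i)) :
    ∃ F ∈ 𝓕, ∀ F' ∈ 𝓕, ∀ i, φ i F ≤ φ i F' := by
  rcases isEmpty_or_nonempty ι with hι | hι
  · exact hne.imp fun F hF => ⟨hF, fun _ _ i => hι.elim i⟩
  have hmin : ∀ i, ∃ F : ℕ → Set X, (∀ n, F n ∈ 𝓕) ∧ ⨅ n, φ i (F n) ≤ sInf (φ i '' 𝓕) := by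
    intro i
    obtain ⟨u, -, hu, hmem⟩ := exists_seq_tendsto_sInf (hne.image (φ i)) (OrderBot.bddBelow _)
    choose F hF hFu using hmem
    exact ⟨F, hF, ge_of_tendsto' hu fun n => (iInf_le _ n).trans (hFu n).le⟩
  choose F hF hFmin using hmin
  obtain ⟨e, he⟩ := exists_surjective_nat (ι × ℕ)
  refine ⟨⋂ n, F (e n).1 (e n).2, hinter _ fun n => hF _ _, fun F' hF' i =>
    (le_iInf fun n => hφ i ?_).trans ((hFmin i).trans (sInf_le (mem_image_of_mem _ hF')))⟩
  obtain ⟨m, hm⟩ := he (i, n)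
  exact (iInter_subset _ m).trans (by rw [hm])

/-- The points over which `A` has at least two points. -/
def multipleValues {X Y : Type*} (f : X → Y) (A : Set X) : Set Y :=
  {y | ∃ x ∈ A, ∃ x' ∈ A, x ≠ x' ∧ f x = y ∧ f x' = y}

/-- The part of `A` over the complement of a measurable hull of `multipleValues f A`. -/
def simplePart {X Y : Type*} [MeasurableSpace Y] (f : X → Y) (μ : Measure Y) (A : Set X) : Set X :=
  A ∩ f ⁻¹' (toMeasurable μ (multipleValues f A))ᶜ

theorem injOn_simplePart {X Y : Type*} [MeasurableSpace Y] (f : X → Y) (μ : Measure Y)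
    (A : Set X) : InjOn f (simplePart f μ A) := by
  intro x hx x' hx' hxx'
  by_contra hne
  exact hx.2 (subset_toMeasurable _ _ ⟨x, hx.1, x', hx'.1, hne, rfl, hxx'.symm⟩)

section StandardBorel

variable {X Y : Type*} [MeasurableSpace X] [MeasurableSpace Y] {f : X → Y}

theorem measurableSet_simplePart (hf : Measurable f) (μ : Measure Y) {A : Set X}
    (hA : MeasurableSet A) : MeasurableSet (simplePart f μ A) :=
  hA.inter (hf (measurableSet_toMeasurable _ _).compl)

variable [StandardBorelSpace X] [TopologicalSpace Y] [PolishSpace Y] [BorelSpace Y]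

theorem analyticSet_multipleValues (hf : Measurable f) {A : Set X} (hA : MeasurableSet A) :
    AnalyticSet (multipleValues f A) := by
  let := upgradeStandardBorel X
  have hpairs : MeasurableSet {p : X × X | p.1 ∈ A ∧ p.2 ∈ A ∧ p.1 ≠ p.2 ∧ f p.1 = f p.2} :=
    (measurable_fst hA).inter <| (measurable_snd hA).inter <|
      (measurableSet_eq_fun measurable_fst measurable_snd).compl.inter <|
        measurableSet_eq_fun (hf.comp measurable_fst) (hf.comp measurable_snd)
  convert hpairs.analyticSet_image (hf.comp measurable_fst) using 1
  ext y
  constructor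
  · rintro ⟨x, hx, x', hx', hne, rfl, hxx'⟩
    exact ⟨(x, x'), ⟨hx, hx', hne, hxx'.symm⟩, rfl⟩
  · rintro ⟨⟨x, x'⟩, ⟨hx, hx', hne, hxx'⟩, rfl⟩
    exact ⟨x, hx, x', hx', hne, rfl, hxx'.symm⟩

theorem ae_fiber_subset_simplePart (hf : Measurable f) (μ : Measure Y) [SFinite μ] {A : Set X}
    (hA : MeasurableSet A) :
    ∀ᵐ y ∂μ, y ∉ multipleValues f A → A ∩ f ⁻¹' {y} ⊆ simplePart f μ A := by
  have hnull := nullMeasurableSet_of_analyticSet (analyticSet_multipleValues hf hA) μ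
  filter_upwards [hnull.toMeasurable_ae_eq.mem_iff] with y hy hmult x hx
  refine ⟨hx.1, fun hfx => hmult (hy.1 ?_)⟩
  rwa [← mem_singleton_iff.1 hx.2]

end StandardBorel

/-- The candidates for the set left over when a measurable `σ`-injective set has been removed: the
proof of the Lusin-Novikov theorem finds one of them whose fibres are almost all empty. -/
structure IsLusinNovikovRemainder {X Y : Type*} [TopologicalSpace X] [MeasurableSpace X]
    [MeasurableSpace Y] (f : X → Y) (μ : Measure Y) (F : Set X) : Prop where
  measurableSet : MeasurableSet F
  isClosed_fiber : ∀ y, IsClosed (F ∩ f ⁻¹' {y})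
  aesigmaInjOn_compl : AESigmaInjOn f μ Fᶜ

namespace IsLusinNovikovRemainder

variable {X Y : Type*} [TopologicalSpace X] [MeasurableSpace X] [MeasurableSpace Y] {f : X → Y}
  {μ : Measure Y} {F : Set X}

theorem univ [TopologicalSpace Y] [T1Space Y] (hf : Continuous f) :
    IsLusinNovikovRemainder f μ univ where
  measurableSet := .univ
  isClosed_fiber y := by rw [univ_inter]; exact isClosed_singleton.preimage hf
  aesigmaInjOn_compl := by rw [compl_univ]; exact .of_injOn .empty (injOn_empty f)

theorem iInter {ι : Type*} [Nonempty ι] [Countable ι] {F : ι → Set X}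
    (hF : ∀ i, IsLusinNovikovRemainder f μ (F i)) : IsLusinNovikovRemainder f μ (⋂ i, F i) where
  measurableSet := .iInter fun i => (hF i).measurableSet
  isClosed_fiber y := by rw [iInter_inter]; exact isClosed_iInter fun i => (hF i).isClosed_fiber y
  aesigmaInjOn_compl := by rw [compl_iInter]; exact .iUnion fun i => (hF i).aesigmaInjOn_compl

theorem diff_iUnion_simplePart [OpensMeasurableSpace X] (hF : IsLusinNovikovRemainder f μ F)
    (hf : Measurable f) {ι : Type*} [Countable ι] {U : ι → Set X} (hU : ∀ i, IsOpen (U i)) :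
    IsLusinNovikovRemainder f μ (F \ ⋃ i, simplePart f μ (F ∩ U i)) where
  measurableSet := hF.measurableSet.diff <| .iUnion fun i =>
    measurableSet_simplePart hf μ (hF.measurableSet.inter (hU i).measurableSet)
  isClosed_fiber y := by
    have hfiber : (F \ ⋃ i, simplePart f μ (F ∩ U i)) ∩ f ⁻¹' {y} = (F ∩ f ⁻¹' {y}) ∩
        (⋃ i ∈ {i | y ∉ toMeasurable μ (multipleValues f (F ∩ U i))}, U i)ᶜ := by
      ext x
      simp only [simplePart, mem_inter_iff, Set.mem_sdiff, mem_iUnion, mem_compl_iff, mem_preimage,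
        mem_singleton_iff, mem_ofPred_eq, exists_prop]
      grind
    rw [hfiber]
    exact (hF.isClosed_fiber y).inter (isOpen_biUnion fun i _ => hU i).isClosed_compl
  aesigmaInjOn_compl := by
    rw [Set.sdiff_eq, compl_inter, compl_compl]
    exact hF.aesigmaInjOn_compl.union <| .iUnion fun i => .of_injOn
      (measurableSet_simplePart hf μ (hF.measurableSet.inter (hU i).measurableSet))
      (injOn_simplePart f μ _)

theorem ae_fiber_eq_empty_of_minimal [PolishSpace X] [BorelSpace X] [TopologicalSpace Y]
    [PolishSpace Y] [BorelSpace Y] [IsFiniteMeasure μ] (hF : IsLusinNovikovRemainder f μ F)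
    (hf : Measurable f) (hcount : ∀ y, (f ⁻¹' {y}).Countable) {ι : Type*} [Countable ι]
    {U : ι → Set X} (hU : TopologicalSpace.IsTopologicalBasis (range U))
    (hmin : ∀ F', IsLusinNovikovRemainder f μ F' →
      ∀ i, μ (f '' (F ∩ U i)) ≤ μ (f '' (F' ∩ U i))) :
    ∀ᵐ y ∂μ, F ∩ f ⁻¹' {y} = ∅ := by
  have hUopen : ∀ i, IsOpen (U i) := fun i => hU.isOpen (mem_range_self i)
  have hFU : ∀ i, MeasurableSet (F ∩ U i) := fun i =>
    hF.measurableSet.inter (hUopen i).measurableSet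
  set F' := F \ ⋃ i, simplePart f μ (F ∩ U i)
  have hF' : IsLusinNovikovRemainder f μ F' := hF.diff_iUnion_simplePart hf hUopen
  have hae_image : ∀ᵐ y ∂μ, ∀ i, y ∈ f '' (F ∩ U i) → y ∈ f '' (F' ∩ U i) := by
    refine ae_all_iff.2 fun i => ?_
    have hnull : NullMeasurableSet (f '' (F' ∩ U i)) μ := nullMeasurableSet_of_analyticSet
      ((hF'.measurableSet.inter (hUopen i).measurableSet).analyticSet_image hf) μ
    filter_upwards [(ae_eq_of_subset_of_measure_ge (image_mono (inter_subset_inter_left _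
      sdiff_subset)) (hmin F' hF' i) hnull (measure_ne_top _ _)).mem_iff] with y hy using hy.2
  filter_upwards [hae_image, ae_all_iff.2 fun i => ae_fiber_subset_simplePart hf μ (hFU i)]
    with y hyimage hysimple
  by_contra hne
  obtain ⟨x, hx, V, hV, hVx⟩ := exists_isOpen_inter_eq_singleton_of_countable
    (hF.isClosed_fiber y) ((hcount y).mono inter_subset_right) (nonempty_iff_ne_empty.2 hne)
  obtain ⟨_, ⟨i, rfl⟩, hxU, hUV⟩ :=
    hU.exists_subset_of_mem_open (hVx.symm.subset (mem_singleton x)).1 hV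
  have hunique : ∀ z ∈ F ∩ U i, f z = y → z = x := fun z hz hzy =>
    hVx.subset ⟨hUV hz.2, hz.1, hzy⟩
  have hmult : y ∉ multipleValues f (F ∩ U i) := by
    rintro ⟨z, hz, z', hz', hzz', hzy, hzy'⟩
    exact hzz' ((hunique z hz hzy).trans (hunique z' hz' hzy').symm)
  obtain ⟨z, ⟨⟨hzF, hzsimple⟩, hzU⟩, hzy⟩ := hyimage i ⟨x, ⟨hx.1, hxU⟩, hx.2⟩
  exact hzsimple (mem_iUnion.2 ⟨i, hysimple i hmult ⟨⟨hzF, hzU⟩, hzy⟩⟩)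

end IsLusinNovikovRemainder

theorem aesigmaInjOn_univ_of_continuous {X Y : Type*} [TopologicalSpace X] [PolishSpace X]
    [MeasurableSpace X] [BorelSpace X] [TopologicalSpace Y] [PolishSpace Y] [MeasurableSpace Y]
    [BorelSpace Y] {f : X → Y} (hf : Continuous f) (hcount : ∀ y, (f ⁻¹' {y}).Countable)
    (μ : Measure Y) [IsFiniteMeasure μ] : AESigmaInjOn f μ univ := by
  have : Countable (TopologicalSpace.countableBasis X) :=
    (TopologicalSpace.countable_countableBasis X).to_subtype
  obtain ⟨F, hF, hFmin⟩ := exists_forall_le_of_iInter_mem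
    (𝓕 := {F | IsLusinNovikovRemainder f μ F})
    (φ := fun (U : TopologicalSpace.countableBasis X) F => μ (f '' (F ∩ U)))
    ⟨univ, .univ hf⟩ (fun F hF => .iInter hF)
    fun U F F' hFF' => measure_mono (image_mono (inter_subset_inter_left _ hFF'))
  have hempty : ∀ᵐ y ∂μ, F ∩ f ⁻¹' {y} = ∅ :=
    IsLusinNovikovRemainder.ae_fiber_eq_empty_of_minimal hF hf.measurable hcount
      (Subtype.range_coe ▸ TopologicalSpace.isBasis_countableBasis X) hFmin
  rw [← union_compl_self F]
  exact (AESigmaInjOn.of_ae_fiber_eq_empty hempty).union hF.aesigmaInjOn_compl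

theorem aesigmaInjOn_univ_of_measurable {X Y : Type*} [MeasurableSpace X] [StandardBorelSpace X]
    [MeasurableSpace Y] [StandardBorelSpace Y] {f : X → Y} (hf : Measurable f)
    (hcount : ∀ y, (f ⁻¹' {y}).Countable) (μ : Measure Y) [IsFiniteMeasure μ] :
    AESigmaInjOn f μ univ := by
  obtain ⟨τX, hborelX, hpolishX⟩ := StandardBorelSpace.polish (α := X)
  let := upgradeStandardBorel Y
  obtain ⟨τ, hle, hcont, hpolish⟩ := hf.exists_continuous
  have hborel : @BorelSpace X τ _ :=
    @BorelSpace.mk X τ _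
      (hborelX.measurable_eq.trans (borel_eq_borel_of_le hpolish hpolishX hle).symm)
  exact @aesigmaInjOn_univ_of_continuous X Y τ hpolish _ hborel _ _ _ _ f hcont hcount μ _

/-- The **Lusin-Novikov theorem**, up to a null set. -/
theorem exists_measurableSet_injOn_ae_fiber_subset_iUnion {X Y : Type*} [MeasurableSpace X]
    [StandardBorelSpace X] [MeasurableSpace Y] [StandardBorelSpace Y] {f : X → Y}
    (hf : Measurable f) (hcount : ∀ y, (f ⁻¹' {y}).Countable) (μ : Measure Y) [SFinite μ] :
    ∃ S : ℕ → Set X, (∀ n, MeasurableSet (S n) ∧ InjOn f (S n)) ∧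
      Pairwise (Function.onFun Disjoint S) ∧ ∀ᵐ y ∂μ, f ⁻¹' {y} ⊆ ⋃ n, S n := by
  obtain ⟨S, hS, hdisj, hcover⟩ :=
    (aesigmaInjOn_univ_of_measurable hf hcount μ.toFinite).exists_pairwise_disjoint
  exact ⟨S, hS, hdisj, (absolutelyContinuous_toFinite μ).ae_le hcover⟩

end LusinNovikov

section FiberCount

/-- The measure `A ↦ ∫ |A ∩ f⁻¹(y)| dμ(y)` induced by `μ` through a countable-to-one map `f`; the
measures `μ_s` and `μ_t` of a groupoid are the cases of the source and the target map. -/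
noncomputable def fiberCountMeasure {X Y : Type*} [MeasurableSpace X] [MeasurableSpace Y]
    (f : X → Y) (μ : Measure Y) : Measure X :=
  μ.bind fun y => Measure.count.restrict (f ⁻¹' {y})

theorem count_le_count_of_mapsTo_of_injOn {X X' : Type*} [MeasurableSpace X] [MeasurableSpace X']
    {s : Set X} {t : Set X'} (hs : MeasurableSet s) (ht : MeasurableSet t) {τ : X → X'}
    (hτ : MapsTo τ s t) (hinj : InjOn τ s) : (Measure.count s : ℝ≥0∞) ≤ Measure.count t := by
  rw [Measure.count_apply hs, Measure.count_apply ht]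
  exact_mod_cast encard_le_encard_of_injOn hτ hinj

theorem count_inter_fiber_of_injOn {X Y : Type*} [MeasurableSpace X] [MeasurableSingletonClass X]
    {f : X → Y} {A : Set X} (hinj : InjOn f A) (y : Y) :
    (Measure.count (A ∩ f ⁻¹' {y}) : ℝ≥0∞) = (f '' A).indicator 1 y := by
  by_cases hy : y ∈ f '' A
  · obtain ⟨x, hx, rfl⟩ := hy
    have hfiber : A ∩ f ⁻¹' {f x} = {x} :=
      Subset.antisymm (fun z hz => hinj hz.1 hx hz.2) (singleton_subset_iff.2 ⟨hx, rfl⟩)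
    rw [hfiber, Measure.count_singleton, indicator_of_mem (mem_image_of_mem f hx), Pi.one_apply]
  · have hfiber : A ∩ f ⁻¹' {y} = ∅ :=
      eq_empty_of_forall_notMem fun x hx => hy ⟨x, hx⟩
    rw [hfiber, measure_empty, indicator_of_notMem hy]

variable {X Y : Type*} [MeasurableSpace X] [StandardBorelSpace X] [MeasurableSpace Y]
  [StandardBorelSpace Y] {f : X → Y} {μ : Measure Y}

theorem measurable_count_restrict_inter_fiber (hf : Measurable f) {S : Set X}
    (hS : MeasurableSet S) (hinj : InjOn f S) :
    Measurable fun y => (Measure.count : Measure X).restrict (S ∩ f ⁻¹' {y}) := by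
  refine Measure.measurable_of_measurable_coe _ fun A hA => ?_
  have hAS : InjOn f (A ∩ S) := hinj.mono inter_subset_right
  simp only [Measure.restrict_apply hA, ← inter_assoc, count_inter_fiber_of_injOn hAS]
  exact measurable_one.indicator ((hA.inter hS).image_of_measurable_injOn hf hAS)

variable [SFinite μ]

theorem aemeasurable_count_restrict_fiber (hf : Measurable f)
    (hcount : ∀ y, (f ⁻¹' {y}).Countable) :
    AEMeasurable (fun y => (Measure.count : Measure X).restrict (f ⁻¹' {y})) μ := by
  obtain ⟨S, hS, hdisj, hcover⟩ :=
    exists_measurableSet_injOn_ae_fiber_subset_iUnion hf hcount μ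
  refine ⟨fun y => Measure.sum fun n => Measure.count.restrict (S n ∩ f ⁻¹' {y}), ?_, ?_⟩
  · refine Measure.measurable_of_measurable_coe _ fun A hA => ?_
    simp only [Measure.sum_apply _ hA]
    exact Measurable.tsum fun n => (Measure.measurable_coe hA).comp
      (measurable_count_restrict_inter_fiber hf (hS n).1 (hS n).2)
  · filter_upwards [hcover] with y hy
    rw [← Measure.restrict_iUnion
      (fun m n hmn => (hdisj hmn).mono inter_subset_left inter_subset_left)
      fun n => (hS n).1.inter (hf (measurableSet_singleton y)), ← iUnion_inter,
      inter_eq_right.2 hy]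

theorem fiberCountMeasure_apply (hf : Measurable f) (hcount : ∀ y, (f ⁻¹' {y}).Countable)
    {A : Set X} (hA : MeasurableSet A) :
    fiberCountMeasure f μ A = ∫⁻ y, Measure.count (A ∩ f ⁻¹' {y}) ∂μ := by
  rw [fiberCountMeasure, Measure.bind_apply hA (aemeasurable_count_restrict_fiber hf hcount)]
  exact lintegral_congr fun y => Measure.restrict_apply hA

theorem aemeasurable_count_inter_fiber (hf : Measurable f) (hcount : ∀ y, (f ⁻¹' {y}).Countable)
    {A : Set X} (hA : MeasurableSet A) :
    AEMeasurable (fun y => (Measure.count (A ∩ f ⁻¹' {y}) : ℝ≥0∞)) μ :=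
  ((Measure.measurable_coe hA).comp_aemeasurable
    (aemeasurable_count_restrict_fiber hf hcount)).congr
    (.of_forall fun _ => Measure.restrict_apply hA)

theorem ae_fiberCountMeasure_iff (hf : Measurable f) (hcount : ∀ y, (f ⁻¹' {y}).Countable)
    {P : X → Prop} :
    (∀ᵐ x ∂(fiberCountMeasure f μ), P x) ↔ ∀ᵐ y ∂μ, ∀ x, f x = y → P x := by
  constructor
  · intro h
    filter_upwards [Measure.ae_ae_of_ae_bind (aemeasurable_count_restrict_fiber hf hcount) h]
      with y hy
    rwa [ae_restrict_iff' (hf (measurableSet_singleton y)), Measure.ae_count_iff] at hy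
  · intro h
    obtain ⟨M, hsub, hM, hMnull⟩ := exists_measurable_superset_of_null (ae_iff.1 h)
    refine measure_mono_null (t := f ⁻¹' M) (fun x hx => hsub fun hP => hx (hP x rfl)) ?_
    rw [fiberCountMeasure_apply hf hcount (hf hM)]
    refine lintegral_eq_zero_of_ae_eq_zero ?_
    filter_upwards [measure_eq_zero_iff_ae_notMem.1 hMnull] with y hy
    rw [← preimage_inter, inter_singleton_eq_empty.2 hy, preimage_empty, measure_empty,
      Pi.zero_apply]

theorem fiberCountMeasure_of_injOn (hf : Measurable f) (hcount : ∀ y, (f ⁻¹' {y}).Countable)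
    {A : Set X} (hA : MeasurableSet A) (hinj : InjOn f A) :
    fiberCountMeasure f μ A = μ (f '' A) := by
  simp only [fiberCountMeasure_apply hf hcount hA, count_inter_fiber_of_injOn hinj]
  exact lintegral_indicator_one (hA.image_of_measurable_injOn hf hinj)

theorem fiberCountMeasure_le_of_mapsTo_of_injOn {X' : Type*} [MeasurableSpace X']
    [StandardBorelSpace X'] {f' : X' → Y} (hf : Measurable f)
    (hcount : ∀ y, (f ⁻¹' {y}).Countable) (hf' : Measurable f')
    (hcount' : ∀ y, (f' ⁻¹' {y}).Countable) {A : Set X} {B : Set X'} (hA : MeasurableSet A)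
    (hB : MeasurableSet B) {τ : X → X'} (hτ : MapsTo τ A B) (hinj : InjOn τ A)
    (hfiber : ∀ x ∈ A, f' (τ x) = f x) : fiberCountMeasure f μ A ≤ fiberCountMeasure f' μ B := by
  rw [fiberCountMeasure_apply hf hcount hA, fiberCountMeasure_apply hf' hcount' hB]
  exact lintegral_mono fun y => count_le_count_of_mapsTo_of_injOn
    (hA.inter (hf (measurableSet_singleton y))) (hB.inter (hf' (measurableSet_singleton y)))
    (fun x hx => ⟨hτ hx.1, (hfiber x hx.1).trans hx.2⟩) (hinj.mono inter_subset_left)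

end FiberCount

namespace DiscreteBorelGroupoid

variable {G : Type*} [MeasurableSpace G] {𝒢 : DiscreteBorelGroupoid G} {μ : Measure G}

theorem IsBorelBisection.mono {A B : Set G} (hA : 𝒢.IsBorelBisection A) (hBA : B ⊆ A)
    (hB : MeasurableSet B) : 𝒢.IsBorelBisection B :=
  ⟨hB, hA.injOn_src.mono hBA, hA.injOn_tgt.mono hBA⟩

variable [StandardBorelSpace G]

theorem ae_muS_iff_src [SFinite μ] {P : G → Prop} :
    (∀ᵐ x ∂(𝒢.muS μ), P x) ↔ ∀ᵐ y ∂μ, ∀ x, 𝒢.src x = y → P x :=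
  ae_fiberCountMeasure_iff 𝒢.measurable_src 𝒢.countable_src_fiber

theorem IsMeasured.ae_muS_iff_tgt (hμ : 𝒢.IsMeasured μ) {P : G → Prop} :
    (∀ᵐ x ∂(𝒢.muS μ), P x) ↔ ∀ᵐ y ∂μ, ∀ x, 𝒢.tgt x = y → P x := by
  have := hμ.isProbabilityMeasure
  rw [← ae_fiberCountMeasure_iff 𝒢.measurable_tgt 𝒢.countable_tgt_fiber]
  exact ⟨fun h => hμ.muT_ac_muS.ae_le h, fun h => hμ.muS_ac_muT.ae_le h⟩

theorem IsBorelBisection.muS_eq [SFinite μ] {A : Set G} (hA : 𝒢.IsBorelBisection A) :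
    𝒢.muS μ A = μ (𝒢.src '' A) :=
  fiberCountMeasure_of_injOn 𝒢.measurable_src 𝒢.countable_src_fiber hA.measurableSet hA.injOn_src

theorem IsBorelBisection.muS_ne_top [IsFiniteMeasure μ] {A : Set G}
    (hA : 𝒢.IsBorelBisection A) : 𝒢.muS μ A ≠ ∞ :=
  hA.muS_eq.trans_ne (measure_ne_top _ _)

theorem IsMeasured.exists_bisection_cover (hμ : 𝒢.IsMeasured μ) :
    ∃ B : ℕ → Set G, (∀ n, 𝒢.IsBorelBisection (B n)) ∧ ∀ᵐ x ∂(𝒢.muS μ), ∃ n, x ∈ B n := by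
  have := hμ.isProbabilityMeasure
  obtain ⟨S, hS, -, hScover⟩ := exists_measurableSet_injOn_ae_fiber_subset_iUnion
    𝒢.measurable_src 𝒢.countable_src_fiber μ
  obtain ⟨T, hT, -, hTcover⟩ := exists_measurableSet_injOn_ae_fiber_subset_iUnion
    𝒢.measurable_tgt 𝒢.countable_tgt_fiber μ
  refine ⟨fun n => S n.unpair.1 ∩ T n.unpair.2, fun n => ⟨(hS _).1.inter (hT _).1,
    (hS _).2.mono inter_subset_left, (hT _).2.mono inter_subset_right⟩, ?_⟩
  filter_upwards [ae_muS_iff_src.2 hScover, hμ.ae_muS_iff_tgt.2 hTcover] with x hxS hxT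
  obtain ⟨m, hm⟩ := mem_iUnion.1 hxS
  obtain ⟨n, hn⟩ := mem_iUnion.1 hxT
  exact ⟨Nat.pair m n, by simpa using ⟨hm, hn⟩⟩

end DiscreteBorelGroupoid

section Lp

theorem eventually_mem_biUnion_finset {X ι : Type*} {B : ι → Set X} {x : X} (hx : ∃ i, x ∈ B i) :
    ∀ᶠ s : Finset ι in atTop, x ∈ ⋃ i ∈ s, B i := by
  obtain ⟨i, hi⟩ := hx
  filter_upwards [eventually_ge_atTop {i}] with s hs
  exact mem_biUnion (hs (Finset.mem_singleton_self i)) hi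

variable {X : Type*} [MeasurableSpace X] {m : Measure X} {p : ℝ≥0∞}

theorem smul_indicatorConstLp_one {𝕜 : Type*} [RCLike 𝕜] {s : Set X} (hs : MeasurableSet s)
    (hfin : m s ≠ ∞) (c : 𝕜) :
    indicatorConstLp p hs hfin c = c • indicatorConstLp p hs hfin (1 : 𝕜) := by
  simp only [indicatorConstLp, ← MemLp.toLp_const_smul]
  congr 1
  ext x
  by_cases hx : x ∈ s <;> simp [hx]

variable [Fact (1 ≤ p)]

theorem exists_seq_tendsto_ae_of_tendsto_Lp {E ι : Type*} [NormedAddCommGroup E] {l : Filter ι}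
    [l.NeBot] [l.IsCountablyGenerated] {u : ι → Lp E p m} {g : Lp E p m} (h : Tendsto u l (𝓝 g)) :
    ∃ φ : ℕ → ι, Tendsto φ atTop l ∧ ∀ᵐ x ∂m, Tendsto (fun n => u (φ n) x) atTop (𝓝 (g x)) :=
  (tendstoInMeasure_of_tendsto_Lp h).exists_seq_tendsto_ae'

theorem exists_seq_tendsto_ae_dominated_of_tendsto_Lp {E : Type*} [NormedAddCommGroup E]
    {u : ℕ → Lp E p m} {g : Lp E p m} (h : Tendsto u atTop (𝓝 g)) :
    ∃ φ : ℕ → ℕ, StrictMono φ ∧ ∃ H : Lp ℝ p m, ∀ᵐ x ∂m,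
      (∀ n, ‖u (φ n) x - g x‖ ≤ H x) ∧ Tendsto (fun n => u (φ n) x) atTop (𝓝 (g x)) := by
  have hlim : Tendsto (fun n => ‖u n - g‖) atTop (𝓝 0) := tendsto_iff_norm_sub_tendsto_zero.1 h
  obtain ⟨φ, hφ, hφ_le⟩ :=
    extraction_forall_of_eventually' (P := fun n i => ‖u i - g‖ ≤ (1 / 2) ^ n) fun n =>
      eventually_atTop.1 (hlim.eventually_le_const (by positivity : (0 : ℝ) < (1 / 2) ^ n))
  let v : ℕ → Lp ℝ p m := fun n => (Lp.memLp (u (φ n) - g)).norm.toLp _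
  have hv : ∀ n, ‖v n‖ ≤ (1 / 2) ^ n := fun n => by
    rw [Lp.norm_toLp, eLpNorm_norm, ← Lp.norm_def]
    exact hφ_le n
  have hsum : ∑' n, ‖v n‖ₑ ≠ ∞ := tsum_enorm_ne_top_iff_summable_norm.2
    (.of_nonneg_of_le (fun _ => norm_nonneg _) hv summable_geometric_two)
  have hvx : ∀ᵐ x ∂m, ∀ n, v n x = ‖u (φ n) x - g x‖ := ae_all_iff.2 fun n => by
    filter_upwards [(Lp.memLp (u (φ n) - g)).norm.coeFn_toLp, Lp.coeFn_sub (u (φ n)) g]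
      with x hx hx'
    rw [hx, hx', Pi.sub_apply]
  refine ⟨φ, hφ, ∑' n, v n, ?_⟩
  filter_upwards [Lp.hasSum_coeFn_tsum hsum, hvx] with x hx hvx
  simp only [hvx] at hx
  exact ⟨fun n => le_hasSum hx n fun _ _ => norm_nonneg _,
    tendsto_iff_norm_sub_tendsto_zero.2 hx.summable.tendsto_atTop_zero⟩

variable {𝕜 : Type*} [RCLike 𝕜]

/-- Multiplication by the indicator function of `U` as an operator on `L^p`, obtained from the
action of `L^∞` on `L^p`. -/
noncomputable def indicatorL {U : Set X} (hU : MeasurableSet U) : Lp 𝕜 p m →L[𝕜] Lp 𝕜 p m :=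
  (ContinuousLinearMap.lsmul 𝕜 𝕜).holderL m ∞ p p
    (((memLp_top_const (1 : 𝕜)).indicator hU).toLp _ : Lp 𝕜 ∞ m)

theorem indicatorL_coeFn {U : Set X} (hU : MeasurableSet U) (g : Lp 𝕜 p m) :
    indicatorL hU g =ᵐ[m] U.indicator g := by
  filter_upwards [((memLp_top_const (1 : 𝕜)).indicator hU).coeFn_toLp (μ := m),
    (ContinuousLinearMap.lsmul 𝕜 𝕜).coeFn_holder (r := p)
      (((memLp_top_const (1 : 𝕜)).indicator hU).toLp _ : Lp 𝕜 ∞ m) g] with x hx hx'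
  refine hx'.trans ?_
  rw [hx]
  by_cases hxU : x ∈ U <;> simp [hxU]

theorem indicatorL_indicatorConstLp {U s : Set X} (hU : MeasurableSet U) (hs : MeasurableSet s)
    (hfin : m s ≠ ∞) (hfin' : m (s ∩ U) ≠ ∞) (c : 𝕜) :
    indicatorL hU (indicatorConstLp p hs hfin c) = indicatorConstLp p (hs.inter hU) hfin' c := by
  apply Lp.ext
  filter_upwards [indicatorConstLp_coeFn (p := p) (hs := hs) (hμs := hfin) (c := c),
    indicatorConstLp_coeFn (p := p) (hs := hs.inter hU) (hμs := hfin') (c := c),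
    indicatorL_coeFn hU (indicatorConstLp p hs hfin c)] with x hs_eq hsU_eq hU_eq
  rw [hU_eq, hsU_eq, inter_comm, ← indicator_indicator]
  by_cases hx : x ∈ U <;> simp [hx, hs_eq]

theorem tendsto_indicatorL {ι : Type*} {l : Filter ι} [l.IsCountablyGenerated] {U : ι → Set X}
    (hU : ∀ i, MeasurableSet (U i)) (hp : p ≠ ∞) (hcov : ∀ᵐ x ∂m, ∀ᶠ i in l, x ∈ U i)
    (g : Lp 𝕜 p m) : Tendsto (fun i => indicatorL (hU i) g) l (𝓝 g) := by
  have hp₀ : p ≠ 0 := (one_pos.trans_le Fact.out).ne'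
  have hp₁ : 0 < p.toReal := ENNReal.toReal_pos hp₀ hp
  have hnorm : ∀ i, eLpNorm (⇑(indicatorL (hU i) g) - ⇑g) p m =
      (∫⁻ x, ‖(U i)ᶜ.indicator g x‖ₑ ^ p.toReal ∂m) ^ (1 / p.toReal) := fun i => by
    rw [eLpNorm_eq_lintegral_rpow_enorm_toReal hp₀ hp]
    congr 1
    refine lintegral_congr_ae ?_
    filter_upwards [indicatorL_coeFn (hU i) g] with x hx
    rw [Pi.sub_apply, hx]
    by_cases hxU : x ∈ U i <;> simp [hxU]
  have hlim : Tendsto (fun i => ∫⁻ x, ‖(U i)ᶜ.indicator g x‖ₑ ^ p.toReal ∂m) l (𝓝 0) := by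
    rw [← lintegral_zero (μ := m)]
    refine tendsto_lintegral_filter_of_dominated_convergence' (fun x => ‖g x‖ₑ ^ p.toReal)
      (.of_forall fun i =>
        ((Lp.memLp g).indicator (hU i).compl).aestronglyMeasurable.enorm.pow_const _)
      (.of_forall fun i => .of_forall fun x => ?_)
      (lintegral_rpow_enorm_lt_top_of_eLpNorm_lt_top hp₀ hp (Lp.memLp g).eLpNorm_lt_top).ne ?_
    · gcongr
      exact enorm_indicator_le_enorm_self _ _
    · filter_upwards [hcov] with x hx
      refine tendsto_const_nhds.congr' ?_
      filter_upwards [hx] with i hi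
      simp [hi, hp₁]
  rw [Lp.tendsto_Lp_iff_tendsto_eLpNorm']
  simp_rw [hnorm]
  simpa [hp₁] using hlim.ennrpow_const (1 / p.toReal)

theorem Lp_induction_of_cover {ι : Type*} [Countable ι] {P : Lp 𝕜 p m → Prop} {B : ι → Set X}
    (hp : p ≠ ∞) (hB : ∀ i, MeasurableSet (B i)) (hcov : ∀ᵐ x ∂m, ∃ i, x ∈ B i) (hP₀ : P 0)
    (hP : ∀ i (E : Set X) (hE : MeasurableSet E) (hfin : m E ≠ ∞), E ⊆ B i →
      P (indicatorConstLp p hE hfin 1))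
    (hadd : ∀ f g, P f → P g → P (f + g)) (hsmul : ∀ (c : 𝕜) f, P f → P (c • f))
    (hclosed : IsClosed {f | P f}) (f : Lp 𝕜 p m) : P f := by
  have hU : ∀ s : Finset ι, MeasurableSet (⋃ i ∈ s, B i) := fun s =>
    s.measurableSet_biUnion fun i _ => hB i
  have hfinset : ∀ (s : Finset ι) (E : Set X) (hE : MeasurableSet E) (hfin : m E ≠ ∞),
      E ⊆ ⋃ i ∈ s, B i → P (indicatorConstLp p hE hfin 1) := by
    intro s
    induction s using Finset.cons_induction with
    | empty =>
      intro E hE hfin hsub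
      obtain rfl : E = ∅ := by simpa using hsub
      simpa using hP₀
    | cons i s _ ih =>
      intro E hE hfin hsub
      have hfin₁ := measure_ne_top_of_subset (inter_subset_left (t := B i)) hfin
      have hfin₂ := measure_ne_top_of_subset (sdiff_subset (t := B i)) hfin
      have hsub₂ : E \ B i ⊆ ⋃ j ∈ s, B j := fun x hx => by simpa [hx.2] using hsub hx.1
      have hsplit := indicatorConstLp_disjoint_union (p := p) (hE.inter (hB i)) (hE.diff (hB i))
        hfin₁ hfin₂ disjoint_sdiff_inter.symm (1 : 𝕜)
      simp only [inter_union_sdiff] at hsplit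
      rw [hsplit]
      exact hadd _ _ (hP i _ _ hfin₁ inter_subset_right) (ih _ _ hfin₂ hsub₂)
  induction f using Lp.induction hp with
  | indicatorConst c hE hfin =>
    rw [Lp.simpleFunc.coe_indicatorConst, smul_indicatorConstLp_one]
    refine hsmul c _ (hclosed.mem_of_tendsto (tendsto_indicatorL hU hp (l := atTop) ?_ _)
      (.of_forall fun s => ?_))
    · filter_upwards [hcov] with x hx using eventually_mem_biUnion_finset hx
    · have hfin' := measure_ne_top_of_subset (inter_subset_left (t := ⋃ i ∈ s, B i)) hfin.ne
      rw [indicatorL_indicatorConstLp (hU s) hE hfin.ne hfin']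
      exact hfinset s _ _ hfin' inter_subset_right
  | add hf hg _ hPf hPg => exact hadd _ _ hPf hPg
  | isClosed => exact hclosed

theorem Lp_continuousLinearMap_ext_of_cover {ι F : Type*} [Countable ι] [NormedAddCommGroup F]
    [NormedSpace 𝕜 F] {T T' : Lp 𝕜 p m →L[𝕜] F} {B : ι → Set X} (hp : p ≠ ∞)
    (hB : ∀ i, MeasurableSet (B i)) (hcov : ∀ᵐ x ∂m, ∃ i, x ∈ B i)
    (h : ∀ i (E : Set X) (hE : MeasurableSet E) (hfin : m E ≠ ∞), E ⊆ B i →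
      T (indicatorConstLp p hE hfin 1) = T' (indicatorConstLp p hE hfin 1)) : T = T' := by
  ext1 f
  refine Lp_induction_of_cover (P := fun f => T f = T' f) hp hB hcov (by simp) h
    (fun f g hf hg => ?_) (fun c f hf => ?_) (isClosed_eq T.continuous T'.continuous) f
  · rw [map_add, map_add, hf, hg]
  · rw [map_smul, map_smul, hf]

end Lp

section FiberSum

variable {X 𝕜 : Type*} [RCLike 𝕜] {σ : X → X} {k : X → X → 𝕜}

/-- The sum `∑_b k(x, b) g(b)` over the fibre of `σ` through `x`. Twisted convolution operators have
this form, with `σ` the source or the target map. -/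
noncomputable def fiberSum (σ : X → X) (k : X → X → 𝕜) (g : X → 𝕜) (x : X) : 𝕜 :=
  ∑' b : {b // σ b = σ x}, k x b * g b

/-- Convergence of the series defining `fiberSum`. -/
def FiberSummable (σ : X → X) (k : X → X → 𝕜) (g : X → 𝕜) (x : X) : Prop :=
  Summable fun b : {b // σ b = σ x} => k x b * g b

theorem fiberSum_congr {g g' : X → 𝕜} {x : X} (h : ∀ b, σ b = σ x → g b = g' b) :
    fiberSum σ k g x = fiberSum σ k g' x :=
  tsum_congr fun b => by rw [h b b.2]

theorem fiberSummable_congr {g g' : X → 𝕜} {x : X} (h : ∀ b, σ b = σ x → g b = g' b) :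
    FiberSummable σ k g x ↔ FiberSummable σ k g' x :=
  summable_congr fun b => by rw [h b b.2]

theorem fiberSum_zero (x : X) : fiberSum σ k 0 x = 0 := by
  simp [fiberSum]

theorem fiberSum_add {g g' : X → 𝕜} {x : X} (h : FiberSummable σ k g x)
    (h' : FiberSummable σ k g' x) :
    fiberSum σ k (g + g') x = fiberSum σ k g x + fiberSum σ k g' x := by
  rw [fiberSum, fiberSum, fiberSum, ← Summable.tsum_add h h']
  exact tsum_congr fun b => by rw [Pi.add_apply, mul_add]

theorem fiberSum_smul (c : 𝕜) (g : X → 𝕜) (x : X) :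
    fiberSum σ k (c • g) x = c * fiberSum σ k g x := by
  rw [fiberSum, fiberSum, ← tsum_mul_left]
  exact tsum_congr fun b => by rw [Pi.smul_apply, smul_eq_mul, mul_left_comm]

theorem fiberSummable_indicator {U : Set X} {x : X} (hU : {b | σ b = σ x ∧ b ∈ U}.Finite)
    (g : X → 𝕜) : FiberSummable σ k (U.indicator g) x := by
  refine summable_of_hasFiniteSupport
    ((hU.preimage Subtype.val_injective.injOn).subset fun b hb => ⟨b.2, ?_⟩)
  by_contra hbU
  exact hb (by simp [hbU])

theorem tendsto_fiberSum_indicator {ι : Type*} {l : Filter ι} {U : Set X} {x : X}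
    (hU : {b | σ b = σ x ∧ b ∈ U}.Finite) {u : ι → X → 𝕜} {g : X → 𝕜}
    (h : ∀ b, σ b = σ x → Tendsto (fun i => u i b) l (𝓝 (g b))) :
    Tendsto (fun i => fiberSum σ k (U.indicator (u i)) x) l
      (𝓝 (fiberSum σ k (U.indicator g) x)) := by
  have hfin := hU.preimage (f := ((↑) : {b // σ b = σ x} → X)) Subtype.val_injective.injOn
  have hsum : ∀ f : X → 𝕜, fiberSum σ k (U.indicator f) x =
      ∑ b ∈ hfin.toFinset, k x b * U.indicator f b := fun f => tsum_eq_sum fun b hb => by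
    have : (b : X) ∉ U := fun hbU => hb (hfin.mem_toFinset.2 ⟨b.2, hbU⟩)
    simp [this]
  simp only [hsum]
  refine tendsto_finsetSum _ fun b _ => Tendsto.const_mul _ ?_
  by_cases hbU : (b : X) ∈ U
  · simpa [hbU] using h b b.2
  · simpa [hbU] using tendsto_const_nhds

theorem finite_fiber_inter_biUnion_of_injOn {ι : Type*} {B : ι → Set X}
    (hinj : ∀ i, InjOn σ (B i)) (s : Finset ι) (x : X) :
    {b | σ b = σ x ∧ b ∈ ⋃ i ∈ s, B i}.Finite := by
  have hsub : {b | σ b = σ x ∧ b ∈ ⋃ i ∈ s, B i} ⊆ ⋃ i ∈ s, {b | σ b = σ x ∧ b ∈ B i} := by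
    rintro b ⟨hb, hbU⟩
    obtain ⟨i, hi, hbi⟩ := mem_iUnion₂.1 hbU
    exact mem_iUnion₂.2 ⟨i, hi, hb, hbi⟩
  exact (s.finite_toSet.biUnion fun i _ => Subsingleton.finite fun b hb b' hb' =>
    hinj i hb.2 hb'.2 (hb.1.trans hb'.1.symm)).subset hsub

theorem exists_measurable_leftInvOn {Y : Type*} [MeasurableSpace X] [StandardBorelSpace X]
    [MeasurableSpace Y] [MeasurableSpace.CountablySeparated Y] [Nonempty X] {f : X → Y}
    (hf : Measurable f) {C : Set X} (hC : MeasurableSet C) (hinj : InjOn f C) :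
    ∃ c : Y → X, Measurable c ∧ LeftInvOn c f C := by
  have := hC.standardBorel
  have hemb : MeasurableEmbedding (C.domRestrict f) :=
    (hf.comp measurable_subtype_coe).measurableEmbedding hinj.injective
  obtain ⟨c, hc, hc'⟩ := hemb.exists_measurable_extend measurable_subtype_coe fun _ => ‹_›
  exact ⟨c, hc, fun x hx => congrFun hc' ⟨x, hx⟩⟩

theorem exists_measurable_norm_le_one_mul_eq_norm [MeasurableSpace X] {z : X → 𝕜}
    (hz : Measurable z) :
    ∃ u : X → 𝕜, Measurable u ∧ (∀ x, ‖u x‖ ≤ 1) ∧ ∀ x, u x * z x = (‖z x‖ : 𝕜) := by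
  refine ⟨fun x => starRingEnd 𝕜 (z x) / (‖z x‖ : 𝕜), ?_, fun x => ?_, fun x => ?_⟩
  · exact (RCLike.continuous_conj.measurable.comp hz).div (RCLike.measurable_ofReal.comp hz.norm)
  · rw [norm_div, RCLike.norm_conj, RCLike.norm_ofReal, abs_norm]
    exact div_self_le_one _
  · rcases eq_or_ne (z x) 0 with h0 | h0
    · simp [h0]
    · have hz0 : (‖z x‖ : 𝕜) ≠ 0 := by simpa using h0
      rw [div_mul_eq_mul_div, div_eq_iff hz0, RCLike.conj_mul, sq]

theorem summable_of_tendsto_tsum_indicator {ι α : Type*} {l : Filter ι} [l.NeBot] {a : α → ℝ}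
    (ha : 0 ≤ a) {V : ι → Set α} (hV : ∀ b, ∀ᶠ i in l, b ∈ V i)
    (hsum : ∀ i, Summable ((V i).indicator a)) {r : ℝ}
    (hlim : Tendsto (fun i => ∑' b, (V i).indicator a b) l (𝓝 r)) : Summable a := by
  refine summable_of_sum_le ha fun s => ge_of_tendsto hlim ?_
  filter_upwards [(Finset.eventually_all s).2 fun b _ => hV b] with i hi
  calc ∑ b ∈ s, a b = ∑ b ∈ s, (V i).indicator a b :=
        Finset.sum_congr rfl fun b hb => (indicator_of_mem (hi b hb) a).symm
    _ ≤ _ := (hsum i).sum_le_tsum s fun b _ => indicator_nonneg (fun b _ => ha b) b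

variable [MeasurableSpace X] {m : Measure X} {p : ℝ≥0∞}

/-- Almost everywhere properties hold on the whole fibre through almost every point, so that
summation along the fibres respects almost everywhere equality. -/
def FiberAE (σ : X → X) (m : Measure X) : Prop :=
  ∀ ⦃P : X → Prop⦄, (∀ᵐ x ∂m, P x) → ∀ᵐ x ∂m, ∀ b, σ b = σ x → P b

/-- The function `fiberSum σ k g` is a well-defined element of `L^p`. -/
def FiberSumMemLp (σ : X → X) (k : X → X → 𝕜) (g : X → 𝕜) (p : ℝ≥0∞) (m : Measure X) : Prop :=
  (∀ᵐ x ∂m, FiberSummable σ k g x) ∧ MemLp (fiberSum σ k g) p m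

theorem FiberAE.fiberSum_ae_eq (hae : FiberAE σ m) {g g' : X → 𝕜} (h : g =ᵐ[m] g') :
    fiberSum σ k g =ᵐ[m] fiberSum σ k g' := by
  filter_upwards [hae h] with x hx using fiberSum_congr hx

theorem FiberAE.exists_linearMap (hae : FiberAE σ m)
    (h : ∀ g : Lp 𝕜 p m, FiberSumMemLp σ k g p m) :
    ∃ T : Lp 𝕜 p m →ₗ[𝕜] Lp 𝕜 p m, ∀ g, T g =ᵐ[m] fiberSum σ k g := by
  refine ⟨{ toFun g := (h g).2.toLp _, map_add' f g := ?_, map_smul' c f := ?_ },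
    fun g => (h g).2.coeFn_toLp⟩
  · rw [← MemLp.toLp_add]
    refine MemLp.toLp_congr _ _ ?_
    filter_upwards [hae.fiberSum_ae_eq (k := k) (Lp.coeFn_add f g), (h f).1, (h g).1]
      with x hfg hf hg
    rw [hfg, fiberSum_add hf hg, Pi.add_apply]
  · rw [RingHom.id_apply, ← MemLp.toLp_const_smul]
    refine MemLp.toLp_congr _ _ ?_
    filter_upwards [hae.fiberSum_ae_eq (k := k) (Lp.coeFn_smul c f)] with x hcf
    rw [hcf, fiberSum_smul, Pi.smul_apply, smul_eq_mul]

variable [Fact (1 ≤ p)]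

theorem FiberAE.existsUnique_continuousLinearMap (hae : FiberAE σ m)
    (h : ∀ g : Lp 𝕜 p m, FiberSumMemLp σ k g p m) :
    ∃! T : Lp 𝕜 p m →L[𝕜] Lp 𝕜 p m, ∀ g, T g =ᵐ[m] fiberSum σ k g := by
  obtain ⟨T, hT⟩ := hae.exists_linearMap h
  have hgraph : ∀ (u : ℕ → Lp 𝕜 p m) (g y : Lp 𝕜 p m), Tendsto u atTop (𝓝 g) →
      Tendsto (T ∘ u) atTop (𝓝 y) → y = T g := by
    intro u g y hu hy
    obtain ⟨φ, hφ, H, hH⟩ := exists_seq_tendsto_ae_dominated_of_tendsto_Lp hu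
    obtain ⟨ψ, hψ, hψae⟩ := exists_seq_tendsto_ae_of_tendsto_Lp (hy.comp hφ.tendsto_atTop)
    have hHmem : MemLp (fun x => (H x : 𝕜)) p m := (Lp.memLp H).ofReal
    apply Lp.ext
    filter_upwards [hψae, ae_all_iff.2 fun n => hT (u (φ (ψ n))), hT g, hae hH,
      hae hHmem.coeFn_toLp, (h (hHmem.toLp _)).1, (h g).1]
      with x hlim hTu hTg hdom hHx hHsum hgsum
    rw [fiberSummable_congr hHx] at hHsum
    rw [hTg]
    refine tendsto_nhds_unique hlim ?_
    simp only [Function.comp_apply, hTu]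
    refine tendsto_tsum_of_dominated_convergence
      (bound := fun b : {b // σ b = σ x} => ‖k x b * (H b : 𝕜)‖ + ‖k x b * g b‖)
      (hHsum.norm.add hgsum.norm)
      (fun b => (((hdom b b.2).2.comp hψ)).const_mul _) (.of_forall fun n b => ?_)
    rw [norm_mul, norm_mul, norm_mul, ← mul_add, RCLike.norm_ofReal]
    gcongr
    have hsub := ((hdom b b.2).1 (ψ n)).trans (le_abs_self _)
    exact (norm_le_norm_sub_add _ _).trans (add_le_add_left hsub _)
  refine ⟨.ofSeqClosedGraph hgraph, hT, fun T' hT' => ?_⟩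
  ext1 g
  exact Lp.ext ((hT' g).trans (hT g).symm)

/-- `T` acts by summation along the fibres of `σ` on the indicator functions of the subsets of the
members of the cover `B`, on which `σ` is injective. -/
structure IsFiberSumOnCover {ι : Type*} (σ : X → X) (k : X → X → 𝕜)
    (T : Lp 𝕜 p m →L[𝕜] Lp 𝕜 p m) (B : ι → Set X) : Prop where
  measurableSet : ∀ i, MeasurableSet (B i)
  injOn : ∀ i, InjOn σ (B i)
  ae_exists_mem : ∀ᵐ x ∂m, ∃ i, x ∈ B i
  apply_indicator : ∀ i (E : Set X) (hE : MeasurableSet E) (hfin : m E ≠ ∞), E ⊆ B i →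
    T (indicatorConstLp p hE hfin 1) =ᵐ[m] fiberSum σ k (E.indicator 1)

namespace IsFiberSumOnCover

variable {ι : Type*} [Countable ι] {T : Lp 𝕜 p m →L[𝕜] Lp 𝕜 p m} {B : ι → Set X}

theorem apply_indicatorL (hT : IsFiberSumOnCover σ k T B) (hae : FiberAE σ m) (hp : p ≠ ∞)
    {U : Set X} (hU : MeasurableSet U) (hfinite : ∀ x, {b | σ b = σ x ∧ b ∈ U}.Finite)
    (g : Lp 𝕜 p m) : T (indicatorL hU g) =ᵐ[m] fiberSum σ k (U.indicator g) := by
  refine Lp_induction_of_cover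
    (P := fun g : Lp 𝕜 p m => T (indicatorL hU g) =ᵐ[m] fiberSum σ k (U.indicator g))
    hp hT.measurableSet hT.ae_exists_mem ?_ (fun i E hE hfin hsub => ?_) (fun f g hf hg => ?_)
    (fun c f hf => ?_) (IsSeqClosed.isClosed fun u g hu hlim => ?_) g
  · rw [map_zero, map_zero]
    filter_upwards [Lp.coeFn_zero 𝕜 p m, hae (Lp.coeFn_zero 𝕜 p m)] with x hx hfib
    rw [hx, Pi.zero_apply, ← fiberSum_zero (σ := σ) (k := k) x]
    refine fiberSum_congr fun b hb => ?_
    rw [indicator_eq_indicator (g := 0) (t := U) Iff.rfl (hfib b hb), indicator_zero']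
  · have hfin' : m (E ∩ U) ≠ ∞ := measure_ne_top_of_subset inter_subset_left hfin
    rw [indicatorL_indicatorConstLp hU hE hfin hfin']
    filter_upwards [hT.apply_indicator i _ (hE.inter hU) hfin' (inter_subset_left.trans hsub),
      hae (indicatorConstLp_coeFn (p := p) (hs := hE) (hμs := hfin) (c := (1 : 𝕜)))] with x hx hfib
    rw [hx]
    refine fiberSum_congr fun b hb => ?_
    by_cases hbU : b ∈ U <;> by_cases hbE : b ∈ E <;> simp [hbU, hbE, hfib b hb]
  · rw [map_add, map_add]
    filter_upwards [hf, hg, Lp.coeFn_add (T (indicatorL hU f)) (T (indicatorL hU g)),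
      hae (Lp.coeFn_add f g)] with x hf hg hadd hfib
    rw [hadd, Pi.add_apply, hf, hg, ← fiberSum_add (fiberSummable_indicator (hfinite x) _)
      (fiberSummable_indicator (hfinite x) _), ← indicator_add']
    exact fiberSum_congr fun b hb => indicator_eq_indicator Iff.rfl (hfib b hb).symm
  · rw [map_smul, map_smul]
    filter_upwards [hf, Lp.coeFn_smul c (T (indicatorL hU f)), hae (Lp.coeFn_smul c f)]
      with x hf hsmul hfib
    rw [hsmul, Pi.smul_apply, hf, smul_eq_mul, ← fiberSum_smul]
    refine fiberSum_congr fun b hb => ?_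
    by_cases hbU : b ∈ U <;> simp [hbU, hfib b hb]
  · obtain ⟨φ, hφ, hφae⟩ := exists_seq_tendsto_ae_of_tendsto_Lp hlim
    obtain ⟨ψ, hψ, hψae⟩ := exists_seq_tendsto_ae_of_tendsto_Lp
      ((((T ∘L indicatorL hU).continuous.tendsto g).comp hlim).comp hφ)
    filter_upwards [hψae, ae_all_iff.2 fun n => hu (φ (ψ n)), hae hφae] with x hTlim hTu hfib
    simp only [Function.comp_apply, ContinuousLinearMap.comp_apply, hTu] at hTlim
    exact tendsto_nhds_unique hTlim
      (tendsto_fiberSum_indicator (hfinite x) fun b hb => (hfib b hb).comp hψ)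

theorem exists_seq_tendsto (hT : IsFiberSumOnCover σ k T B) (hae : FiberAE σ m) (hp : p ≠ ∞)
    (g : Lp 𝕜 p m) :
    ∃ s : ℕ → Finset ι, Tendsto s atTop atTop ∧ ∀ᵐ x ∂m,
      Tendsto (fun n => fiberSum σ k ((⋃ i ∈ s n, B i).indicator g) x) atTop (𝓝 (T g x)) := by
  have hU : ∀ s : Finset ι, MeasurableSet (⋃ i ∈ s, B i) := fun s =>
    s.measurableSet_biUnion fun i _ => hT.measurableSet i
  have hcov : ∀ᵐ x ∂m, ∀ᶠ s : Finset ι in atTop, x ∈ ⋃ i ∈ s, B i := by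
    filter_upwards [hT.ae_exists_mem] with x hx using eventually_mem_biUnion_finset hx
  obtain ⟨s, hs, hsae⟩ := exists_seq_tendsto_ae_of_tendsto_Lp
    ((T.continuous.tendsto g).comp (tendsto_indicatorL hU hp hcov g))
  refine ⟨s, hs, ?_⟩
  filter_upwards [hsae, ae_all_iff.2 fun n => hT.apply_indicatorL hae hp (hU (s n))
    (finite_fiber_inter_biUnion_of_injOn hT.injOn _) g] with x hlim hx
  simpa only [Function.comp_apply, hx] using hlim

theorem ae_fiberSummable [StandardBorelSpace X] (hT : IsFiberSumOnCover σ k T B)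
    (hae : FiberAE σ m) (hp : p ≠ ∞) (hσ : Measurable σ) (hk : Measurable (Function.uncurry k))
    (g : Lp 𝕜 p m) : ∀ᵐ x ∂m, FiberSummable σ k g x := by
  suffices h : ∀ i, ∀ᵐ x ∂m, x ∈ B i → FiberSummable σ k g x by
    filter_upwards [hT.ae_exists_mem, ae_all_iff.2 h] with x ⟨i, hi⟩ hx using hx i hi
  intro i
  rcases isEmpty_or_nonempty X with hX | hX
  · exact .of_forall fun x => hX.elim x
  -- Multiplying `g` by a phase makes all terms of the series at the points of `B i` nonnegative.
  obtain ⟨c, hc, hcB⟩ := exists_measurable_leftInvOn hσ (hT.measurableSet i) (hT.injOn i)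
  have hz : Measurable fun b => k (c (σ b)) b * g b :=
    (hk.comp ((hc.comp hσ).prodMk measurable_id)).mul (Lp.stronglyMeasurable g).measurable
  obtain ⟨u, hu, hu_le, huz⟩ := exists_measurable_norm_le_one_mul_eq_norm hz
  have hmem : MemLp (fun b => u b * g b) p m := (Lp.memLp g).of_le
    (hu.aestronglyMeasurable.mul (Lp.aestronglyMeasurable g)) (.of_forall fun b => by
      rw [norm_mul]
      exact mul_le_of_le_one_left (norm_nonneg _) (hu_le b))
  obtain ⟨s, hs, hsae⟩ := hT.exists_seq_tendsto hae hp (hmem.toLp _)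
  filter_upwards [hsae, hae hmem.coeFn_toLp, hae hT.ae_exists_mem] with x hlim hgx hcov hxB
  let V : ℕ → Set {b // σ b = σ x} := fun n => (↑) ⁻¹' ⋃ i ∈ s n, B i
  have hterm : ∀ n (b : {b // σ b = σ x}), k x b * (⋃ i ∈ s n, B i).indicator (hmem.toLp _) b =
      (((V n).indicator (fun b => ‖k x b * g b‖) b : ℝ) : 𝕜) := by
    intro n b
    by_cases hb : (b : X) ∈ ⋃ i ∈ s n, B i
    · have hbz := huz b
      simp only [b.2, hcB hxB] at hbz
      rw [indicator_of_mem hb, indicator_of_mem (show b ∈ V n from hb), hgx b b.2, ← hbz]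
      ring
    · rw [indicator_of_notMem hb, indicator_of_notMem (show b ∉ V n from hb), mul_zero,
        RCLike.ofReal_zero]
  have hsum : ∀ n, Summable ((V n).indicator fun b => ‖k x b * g b‖) := fun n => by
    have := fiberSummable_indicator (k := k)
      (finite_fiber_inter_biUnion_of_injOn hT.injOn (s n) x) (hmem.toLp _)
    simp only [FiberSummable, hterm] at this
    exact (RCLike.summable_ofReal 𝕜).1 this
  refine .of_norm (summable_of_tendsto_tsum_indicator (V := V) (fun _ => norm_nonneg _)
    (fun b => hs.eventually (eventually_mem_biUnion_finset (hcov b b.2))) hsum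
    (r := RCLike.re (T (hmem.toLp _) x)) ?_)
  simp only [fiberSum, hterm, ← RCLike.ofReal_tsum] at hlim
  simpa only [Function.comp_def, RCLike.ofReal_re] using (RCLike.continuous_re.tendsto _).comp hlim

theorem apply_ae_eq_fiberSum [StandardBorelSpace X] (hT : IsFiberSumOnCover σ k T B)
    (hae : FiberAE σ m) (hp : p ≠ ∞) (hσ : Measurable σ) (hk : Measurable (Function.uncurry k))
    (g : Lp 𝕜 p m) : T g =ᵐ[m] fiberSum σ k g := by
  obtain ⟨s, hs, hsae⟩ := hT.exists_seq_tendsto hae hp g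
  filter_upwards [hsae, hT.ae_fiberSummable hae hp hσ hk g, hae hT.ae_exists_mem]
    with x hlim hsum hcov
  refine tendsto_nhds_unique hlim (tendsto_tsum_of_dominated_convergence
    (bound := fun b : {b // σ b = σ x} => ‖k x b * g b‖) hsum.norm (fun b => ?_)
    (.of_forall fun n b => ?_))
  · refine tendsto_const_nhds.congr' ?_
    filter_upwards [hs.eventually (eventually_mem_biUnion_finset (hcov b b.2))] with n hn
    rw [indicator_of_mem hn]
  · rw [norm_mul, norm_mul]
    gcongr
    exact norm_indicator_le_norm_self _ _

end IsFiberSumOnCover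

end FiberSum

namespace DiscreteBorelGroupoid

variable {G : Type*} [MeasurableSpace G] {𝒢 : DiscreteBorelGroupoid G}

protected theorem mul_inv_cancel_right {a b : G} (h : 𝒢.src a = 𝒢.tgt b) :
    𝒢.mul (𝒢.mul a b) (𝒢.inv b) = a := by
  rw [𝒢.mul_assoc _ _ _ h (𝒢.tgt_inv b).symm, 𝒢.mul_inv, ← h, 𝒢.mul_src_self]

protected theorem inv_mul_cancel_right {x b : G} (h : 𝒢.src b = 𝒢.src x) :
    𝒢.mul (𝒢.mul x (𝒢.inv b)) b = x := by
  rw [𝒢.mul_assoc _ _ _ (by rw [𝒢.tgt_inv, h]) (𝒢.src_inv b), 𝒢.inv_mul, h, 𝒢.mul_src_self]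

protected theorem inv_mul_cancel_left {a b : G} (h : 𝒢.src a = 𝒢.tgt b) :
    𝒢.mul (𝒢.inv a) (𝒢.mul a b) = b := by
  rw [← 𝒢.mul_assoc _ _ _ (𝒢.src_inv a) h, 𝒢.inv_mul, h, 𝒢.tgt_mul_self]

protected theorem mul_inv_cancel_left {x a : G} (h : 𝒢.tgt a = 𝒢.tgt x) :
    𝒢.mul a (𝒢.mul (𝒢.inv a) x) = x := by
  rw [← 𝒢.mul_assoc _ _ _ (𝒢.tgt_inv a).symm (by rw [𝒢.src_inv, h]), 𝒢.mul_inv, h,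
    𝒢.tgt_mul_self]

protected theorem mul_left_cancel {a b b' : G} (h : 𝒢.src a = 𝒢.tgt b) (h' : 𝒢.src a = 𝒢.tgt b')
    (heq : 𝒢.mul a b = 𝒢.mul a b') : b = b' := by
  rw [← 𝒢.inv_mul_cancel_left h, heq, 𝒢.inv_mul_cancel_left h']

protected theorem mul_right_cancel {a a' b : G} (h : 𝒢.src a = 𝒢.tgt b) (h' : 𝒢.src a' = 𝒢.tgt b)
    (heq : 𝒢.mul a b = 𝒢.mul a' b) : a = a' := by
  rw [← 𝒢.mul_inv_cancel_right h, heq, 𝒢.mul_inv_cancel_right h']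

protected theorem inv_inv (g : G) : 𝒢.inv (𝒢.inv g) = g := by
  have h := 𝒢.inv_mul_cancel_left (𝒢.src_inv g)
  rw [𝒢.inv_mul, ← 𝒢.tgt_inv, ← 𝒢.src_inv (𝒢.inv g), 𝒢.mul_src_self] at h
  exact h

theorem src_mul_inv {x b : G} (h : 𝒢.src b = 𝒢.src x) :
    𝒢.src (𝒢.mul x (𝒢.inv b)) = 𝒢.tgt b := by
  rw [𝒢.src_mul _ _ (by rw [𝒢.tgt_inv, h]), 𝒢.src_inv]

theorem tgt_inv_mul {x a : G} (h : 𝒢.tgt a = 𝒢.tgt x) :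
    𝒢.tgt (𝒢.mul (𝒢.inv a) x) = 𝒢.src a := by
  rw [𝒢.tgt_mul _ _ (by rw [𝒢.src_inv, h]), 𝒢.tgt_inv]

theorem setInv_eq_preimage (A : Set G) : 𝒢.setInv A = 𝒢.inv ⁻¹' A :=
  congrFun (image_eq_preimage_of_inverse 𝒢.inv_inv 𝒢.inv_inv) A

theorem setInv_setInv (A : Set G) : 𝒢.setInv (𝒢.setInv A) = A := by
  rw [setInv, setInv, image_image]
  simp only [𝒢.inv_inv, image_id']

theorem IsBorelBisection.setInv {A : Set G} (hA : 𝒢.IsBorelBisection A) :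
    𝒢.IsBorelBisection (𝒢.setInv A) := by
  refine ⟨?_, ?_, ?_⟩
  · rw [setInv_eq_preimage]
    exact 𝒢.measurable_inv hA.measurableSet
  · rintro _ ⟨a, ha, rfl⟩ _ ⟨b, hb, rfl⟩ h
    rw [𝒢.src_inv, 𝒢.src_inv] at h
    rw [hA.injOn_tgt ha hb h]
  · rintro _ ⟨a, ha, rfl⟩ _ ⟨b, hb, rfl⟩ h
    rw [𝒢.tgt_inv, 𝒢.tgt_inv] at h
    rw [hA.injOn_src ha hb h]

theorem setMul_mono {A A' B B' : Set G} (hA : A ⊆ A') (hB : B ⊆ B') :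
    𝒢.setMul A B ⊆ 𝒢.setMul A' B' := by
  rintro _ ⟨a, ha, b, hb, hab, rfl⟩
  exact ⟨a, hA ha, b, hB hb, hab, rfl⟩

theorem Cocycle.conj_conj (ω : 𝒢.Cocycle) : ω.conj.conj = ω := by
  cases ω
  simp only [Cocycle.conj, _root_.inv_inv]

theorem Cocycle.coe_conj (ω : 𝒢.Cocycle) (a b : G) :
    (ω.conj.toFun a b : ℂ) = star (ω.toFun a b : ℂ) :=
  Circle.coe_inv_eq_conj _

section Conv

variable (ω : 𝒢.Cocycle) {f g : G → ℂ}

theorem support_conv_subset :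
    Function.support (conv ω f g) ⊆ 𝒢.setMul (Function.support f) (Function.support g) := by
  intro x hx
  by_contra hxfg
  refine hx ((tsum_congr fun p => ?_).trans tsum_zero)
  by_contra hp
  exact hxfg ⟨p.1.1, right_ne_zero_of_mul (left_ne_zero_of_mul hp), p.1.2,
    right_ne_zero_of_mul hp, p.2.1, p.2.2⟩

theorem conv_mul_of_unique {a b : G} (hab : 𝒢.src a = 𝒢.tgt b)
    (h : ∀ a' b', 𝒢.src a' = 𝒢.tgt b' → 𝒢.mul a' b' = 𝒢.mul a b → f a' ≠ 0 → g b' ≠ 0 →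
      a' = a ∧ b' = b) :
    conv ω f g (𝒢.mul a b) = ω.toFun a b * f a * g b := by
  refine tsum_eq_single (⟨(a, b), hab, rfl⟩ : 𝒢.factorizations (𝒢.mul a b)) ?_
  rintro ⟨⟨a', b'⟩, hab', heq⟩ hne
  by_contra h0
  obtain ⟨rfl, rfl⟩ := h a' b' hab' heq (right_ne_zero_of_mul (left_ne_zero_of_mul h0))
    (right_ne_zero_of_mul h0)
  exact hne rfl

theorem conv_indicator_left_mul {A : Set G} (hA : InjOn 𝒢.tgt A) (g : G → ℂ) {a e : G}
    (ha : a ∈ A) (hae : 𝒢.src a = 𝒢.tgt e) :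
    conv ω (A.indicator 1) g (𝒢.mul a e) = ω.toFun a e * g e := by
  rw [conv_mul_of_unique ω hae, indicator_of_mem ha, Pi.one_apply, mul_one]
  intro a' e' hae' heq ha' _
  obtain rfl : a' = a := hA (mem_of_indicator_ne_zero ha') ha
    (by rw [← 𝒢.tgt_mul _ _ hae', heq, 𝒢.tgt_mul _ _ hae])
  exact ⟨rfl, 𝒢.mul_left_cancel hae' hae heq⟩

theorem conv_indicator_right_mul {E : Set G} (hE : InjOn 𝒢.src E) (f : G → ℂ) {a e : G}
    (he : e ∈ E) (hae : 𝒢.src a = 𝒢.tgt e) :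
    conv ω f (E.indicator 1) (𝒢.mul a e) = ω.toFun a e * f a := by
  rw [conv_mul_of_unique ω hae, indicator_of_mem he, Pi.one_apply, mul_one]
  intro a' e' hae' heq _ he'
  obtain rfl : e' = e := hE (mem_of_indicator_ne_zero he') he
    (by rw [← 𝒢.src_mul _ _ hae', heq, 𝒢.src_mul _ _ hae])
  exact ⟨𝒢.mul_right_cancel hae' hae heq, rfl⟩

theorem conv_indicator_indicator_of_notMem {A E : Set G} {x : G} (hx : x ∉ 𝒢.setMul A E) :
    conv ω (A.indicator 1) (E.indicator 1) x = 0 := by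
  by_contra h
  exact hx (setMul_mono support_indicator_subset support_indicator_subset
    (support_conv_subset ω h))

theorem eq_conv_indicator_indicator_iff {A E : Set G} (h : InjOn 𝒢.tgt A ∨ InjOn 𝒢.src E) {x : G}
    {z : ℂ} : ((∀ a ∈ A, ∀ e ∈ E, 𝒢.src a = 𝒢.tgt e → 𝒢.mul a e = x → z = ω.toFun a e) ∧
      (x ∉ 𝒢.setMul A E → z = 0)) ↔ z = conv ω (A.indicator 1) (E.indicator 1) x := by
  have hmul : ∀ a ∈ A, ∀ e ∈ E, 𝒢.src a = 𝒢.tgt e →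
      conv ω (A.indicator 1) (E.indicator 1) (𝒢.mul a e) = ω.toFun a e := by
    intro a ha e he hae
    rcases h with h | h
    · simp [conv_indicator_left_mul ω h _ ha hae, he]
    · simp [conv_indicator_right_mul ω h _ he hae, ha]
  constructor
  · rintro ⟨hval, hzero⟩
    by_cases hx : x ∈ 𝒢.setMul A E
    · obtain ⟨a, ha, e, he, hae, rfl⟩ := hx
      rw [hmul a ha e he hae, hval a ha e he hae rfl]
    · rw [conv_indicator_indicator_of_notMem ω hx, hzero hx]
  · rintro rfl
    refine ⟨?_, fun hx => conv_indicator_indicator_of_notMem ω hx⟩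
    rintro a ha e he hae rfl
    exact hmul a ha e he hae

theorem injOn_src_units : InjOn 𝒢.src 𝒢.units := fun x hx _ hy h =>
  (show 𝒢.src x = x from hx).symm.trans (h.trans hy)

theorem injOn_tgt_units : InjOn 𝒢.tgt 𝒢.units := fun x hx y hy h => by
  have htgt : ∀ e ∈ 𝒢.units, 𝒢.tgt e = e := fun e (he : 𝒢.src e = e) => by rw [← he, 𝒢.tgt_src]
  rw [← htgt x hx, h, htgt y hy]

theorem isBorelBisection_units : 𝒢.IsBorelBisection 𝒢.units :=
  ⟨𝒢.measurableSet_units, injOn_src_units, injOn_tgt_units⟩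

theorem conv_indicator_units (f : G → ℂ) : conv ω f (𝒢.units.indicator 1) = f := by
  ext x
  have h := conv_indicator_right_mul ω injOn_src_units f (𝒢.src_src x) (𝒢.tgt_src x).symm
  rwa [𝒢.mul_src_self, ω.map_src, Circle.coe_one, one_mul] at h

theorem indicator_units_conv (g : G → ℂ) : conv ω (𝒢.units.indicator 1) g = g := by
  ext x
  have h := conv_indicator_left_mul ω injOn_tgt_units g (𝒢.src_tgt x) (𝒢.src_tgt x)
  rwa [𝒢.tgt_mul_self, ω.map_tgt, Circle.coe_one, one_mul] at h

end Conv

section Assoc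

variable (𝒢) in
/-- The composable triples `(a, b, c)` with `a b c = x` and `b ∈ B`. -/
def factorizationsThrough (B : Set G) (x : G) : Set (G × G × G) :=
  {q | q.2.1 ∈ B ∧ 𝒢.src q.1 = 𝒢.tgt q.2.1 ∧ 𝒢.src q.2.1 = 𝒢.tgt q.2.2 ∧
    𝒢.mul q.1 (𝒢.mul q.2.1 q.2.2) = x}

variable {B : Set G} (ω : 𝒢.Cocycle)

theorem conv_conv_indicator_left (hB : InjOn 𝒢.tgt B) (f h : G → ℂ) (x : G) :
    conv ω f (conv ω (B.indicator 1) h) x = ∑' q : 𝒢.factorizationsThrough B x,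
      (ω.toFun q.1.1 (𝒢.mul q.1.2.1 q.1.2.2) : ℂ) * f q.1.1 *
        (ω.toFun q.1.2.1 q.1.2.2 * h q.1.2.2) := by
  let i : 𝒢.factorizationsThrough B x → 𝒢.factorizations x := fun q =>
    ⟨(q.1.1, 𝒢.mul q.1.2.1 q.1.2.2), q.2.2.1.trans (𝒢.tgt_mul _ _ q.2.2.2.1).symm, q.2.2.2.2⟩
  have hi : Function.Injective i := by
    rintro ⟨⟨a, b, c⟩, hb, hab, hbc, _⟩ ⟨⟨a', b', c'⟩, hb', hab', hbc', _⟩ heq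
    have hmul : 𝒢.mul b c = 𝒢.mul b' c' := congrArg (fun p => p.1.2) heq
    obtain rfl : a = a' := congrArg (fun p => p.1.1) heq
    obtain rfl : b = b' := hB hb hb' (hab.symm.trans hab')
    obtain rfl : c = c' := 𝒢.mul_left_cancel hbc hbc' hmul
    rfl
  have hsupp : Function.support (fun p : 𝒢.factorizations x => (ω.toFun p.1.1 p.1.2 : ℂ) * f p.1.1 *
      conv ω (B.indicator 1) h p.1.2) ⊆ range i := by
    rintro ⟨⟨a, d⟩, had, hx⟩ hp
    obtain ⟨b, hb, c, -, hbc, rfl⟩ := support_conv_subset ω (right_ne_zero_of_mul hp)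
    exact ⟨⟨(a, b, c), support_indicator_subset hb, had.trans (𝒢.tgt_mul _ _ hbc), hbc, hx⟩, rfl⟩
  refine (hi.tsum_eq hsupp).symm.trans (tsum_congr ?_)
  rintro ⟨⟨a, b, c⟩, hb, -, hbc, -⟩
  simp only [i, conv_indicator_left_mul ω hB h hb hbc]

theorem conv_conv_indicator_right (hB : InjOn 𝒢.src B) (f h : G → ℂ) (x : G) :
    conv ω (conv ω f (B.indicator 1)) h x = ∑' q : 𝒢.factorizationsThrough B x,
      (ω.toFun (𝒢.mul q.1.1 q.1.2.1) q.1.2.2 : ℂ) *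
        (ω.toFun q.1.1 q.1.2.1 * f q.1.1) * h q.1.2.2 := by
  let j : 𝒢.factorizationsThrough B x → 𝒢.factorizations x := fun q =>
    ⟨(𝒢.mul q.1.1 q.1.2.1, q.1.2.2), (𝒢.src_mul _ _ q.2.2.1).trans q.2.2.2.1,
      (𝒢.mul_assoc _ _ _ q.2.2.1 q.2.2.2.1).trans q.2.2.2.2⟩
  have hj : Function.Injective j := by
    rintro ⟨⟨a, b, c⟩, hb, hab, hbc, _⟩ ⟨⟨a', b', c'⟩, hb', hab', hbc', _⟩ heq
    have hmul : 𝒢.mul a b = 𝒢.mul a' b' := congrArg (fun p => p.1.1) heq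
    obtain rfl : c = c' := congrArg (fun p => p.1.2) heq
    obtain rfl : b = b' := hB hb hb' (hbc.trans hbc'.symm)
    obtain rfl : a = a' := 𝒢.mul_right_cancel hab hab' hmul
    rfl
  have hsupp : Function.support (fun p : 𝒢.factorizations x => (ω.toFun p.1.1 p.1.2 : ℂ) *
      conv ω f (B.indicator 1) p.1.1 * h p.1.2) ⊆ range j := by
    rintro ⟨⟨d, c⟩, hdc, hx⟩ hp
    obtain ⟨a, -, b, hb, hab, rfl⟩ :=
      support_conv_subset ω (right_ne_zero_of_mul (left_ne_zero_of_mul hp))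
    have hbc : 𝒢.src b = 𝒢.tgt c := (𝒢.src_mul _ _ hab).symm.trans hdc
    exact ⟨⟨(a, b, c), support_indicator_subset hb, hab, hbc,
      (𝒢.mul_assoc _ _ _ hab hbc).symm.trans hx⟩, rfl⟩
  refine (hj.tsum_eq hsupp).symm.trans (tsum_congr ?_)
  rintro ⟨⟨a, b, c⟩, hb, hab, -, -⟩
  simp only [j, conv_indicator_right_mul ω hB f hb hab]

theorem conv_conv_indicator_assoc (hs : InjOn 𝒢.src B) (ht : InjOn 𝒢.tgt B) (f h : G → ℂ) :
    conv ω f (conv ω (B.indicator 1) h) = conv ω (conv ω f (B.indicator 1)) h := by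
  ext x
  rw [conv_conv_indicator_left ω ht, conv_conv_indicator_right ω hs]
  refine tsum_congr ?_
  rintro ⟨⟨a, b, c⟩, -, hab, hbc, -⟩
  have hω : (ω.toFun a (𝒢.mul b c) * ω.toFun b c : ℂ) = ω.toFun (𝒢.mul a b) c * ω.toFun a b := by
    exact_mod_cast congrArg ((↑) : Circle → ℂ) (ω.cocycle a b c hab hbc)
  linear_combination (f a * h c) * hω

end Assoc

section Kernel

variable (𝒢) in
/-- Factorizations `x = a b` correspond to arrows `b` with the source of `x`. -/
def factorizationsEquivSrc (x : G) : 𝒢.factorizations x ≃ {b // 𝒢.src b = 𝒢.src x} where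
  toFun p := ⟨p.1.2, (𝒢.src_mul _ _ p.2.1).symm.trans (congrArg 𝒢.src p.2.2)⟩
  invFun b := ⟨(𝒢.mul x (𝒢.inv b), b), src_mul_inv b.2, 𝒢.inv_mul_cancel_right b.2⟩
  left_inv p := by
    obtain ⟨⟨a, b⟩, h, rfl⟩ := p
    exact Subtype.ext (Prod.ext (𝒢.mul_inv_cancel_right h) rfl)
  right_inv b := rfl

variable (𝒢) in
/-- Factorizations `x = a b` correspond to arrows `a` with the target of `x`. -/
def factorizationsEquivTgt (x : G) : 𝒢.factorizations x ≃ {a // 𝒢.tgt a = 𝒢.tgt x} where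
  toFun p := ⟨p.1.1, (𝒢.tgt_mul _ _ p.2.1).symm.trans (congrArg 𝒢.tgt p.2.2)⟩
  invFun a := ⟨(a, 𝒢.mul (𝒢.inv a) x), (tgt_inv_mul a.2).symm, 𝒢.mul_inv_cancel_left a.2⟩
  left_inv p := by
    obtain ⟨⟨a, b⟩, h, rfl⟩ := p
    exact Subtype.ext (Prod.ext rfl (𝒢.inv_mul_cancel_left h))
  right_inv a := rfl

open Classical in
variable (𝒢) in
/-- The product, extended to all pairs of arrows by the junk value `p.1`. Being defined on a product
space, it makes the measurability of maps built from products a matter of composition. -/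
noncomputable def mulExt (p : G × G) : G := if 𝒢.src p.1 = 𝒢.tgt p.2 then 𝒢.mul p.1 p.2 else p.1

open Classical in
/-- The cocycle as a complex function, extended by zero to all pairs of arrows. -/
noncomputable def Cocycle.zeroExt (ω : 𝒢.Cocycle) (p : G × G) : ℂ :=
  if 𝒢.src p.1 = 𝒢.tgt p.2 then (ω.toFun p.1 p.2 : ℂ) else 0

theorem mulExt_of_src_eq {a b : G} (h : 𝒢.src a = 𝒢.tgt b) : 𝒢.mulExt (a, b) = 𝒢.mul a b :=
  if_pos h

theorem Cocycle.zeroExt_of_src_eq (ω : 𝒢.Cocycle) {a b : G} (h : 𝒢.src a = 𝒢.tgt b) :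
    ω.zeroExt (a, b) = ω.toFun a b :=
  if_pos h

variable (ω : 𝒢.Cocycle) (f g : G → ℂ)

/-- The kernel `ω(x b⁻¹, b) f(x b⁻¹)` of the operator `g ↦ f *_ω g`; see `conv_eq_fiberSum_src`. -/
noncomputable def leftKernel (x b : G) : ℂ :=
  ω.zeroExt (𝒢.mulExt (x, 𝒢.inv b), b) * f (𝒢.mulExt (x, 𝒢.inv b))

/-- The kernel `ω(a, a⁻¹ x) f(a⁻¹ x)` of the operator `g ↦ g *_ω f`; see `conv_eq_fiberSum_tgt`. -/
noncomputable def rightKernel (x a : G) : ℂ :=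
  ω.zeroExt (a, 𝒢.mulExt (𝒢.inv a, x)) * f (𝒢.mulExt (𝒢.inv a, x))

theorem leftKernel_of_src_eq {x b : G} (h : 𝒢.src b = 𝒢.src x) :
    leftKernel ω f x b = ω.toFun (𝒢.mul x (𝒢.inv b)) b * f (𝒢.mul x (𝒢.inv b)) := by
  rw [leftKernel, mulExt_of_src_eq (by rw [𝒢.tgt_inv, h]), ω.zeroExt_of_src_eq (src_mul_inv h)]

theorem rightKernel_of_tgt_eq {x a : G} (h : 𝒢.tgt a = 𝒢.tgt x) :
    rightKernel ω f x a = ω.toFun a (𝒢.mul (𝒢.inv a) x) * f (𝒢.mul (𝒢.inv a) x) := by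
  rw [rightKernel, mulExt_of_src_eq (by rw [𝒢.src_inv, h]),
    ω.zeroExt_of_src_eq (tgt_inv_mul h).symm]

theorem conv_eq_fiberSum_src : conv ω f g = fiberSum 𝒢.src (leftKernel ω f) g := by
  ext x
  rw [conv, fiberSum, ← (𝒢.factorizationsEquivSrc x).symm.tsum_eq]
  exact tsum_congr fun b => by rw [leftKernel_of_src_eq ω f b.2]; rfl

theorem conv_eq_fiberSum_tgt : conv ω g f = fiberSum 𝒢.tgt (rightKernel ω f) g := by
  ext x
  rw [conv, fiberSum, ← (𝒢.factorizationsEquivTgt x).symm.tsum_eq]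
  exact tsum_congr fun a => by rw [rightKernel_of_tgt_eq ω f a.2, mul_right_comm]; rfl

theorem summable_conv_iff_src (x : G) :
    (Summable fun p : 𝒢.factorizations x => (ω.toFun p.1.1 p.1.2 : ℂ) * f p.1.1 * g p.1.2) ↔
      FiberSummable 𝒢.src (leftKernel ω f) g x := by
  rw [← (𝒢.factorizationsEquivSrc x).symm.summable_iff]
  exact summable_congr fun b => by rw [leftKernel_of_src_eq ω f b.2]; rfl

theorem summable_conv_iff_tgt (x : G) :
    (Summable fun p : 𝒢.factorizations x => (ω.toFun p.1.1 p.1.2 : ℂ) * g p.1.1 * f p.1.2) ↔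
      FiberSummable 𝒢.tgt (rightKernel ω f) g x := by
  rw [← (𝒢.factorizationsEquivTgt x).symm.summable_iff]
  exact summable_congr fun a => by rw [rightKernel_of_tgt_eq ω f a.2, mul_right_comm]; rfl

theorem convMemL2_iff_src {μ : Measure G} :
    ConvMemL2 μ ω f g ↔ FiberSumMemLp 𝒢.src (leftKernel ω f) g 2 (𝒢.muS μ) := by
  simp only [ConvMemL2, FiberSumMemLp, summable_conv_iff_src, conv_eq_fiberSum_src]

theorem convMemL2_iff_tgt {μ : Measure G} :
    ConvMemL2 μ ω g f ↔ FiberSumMemLp 𝒢.tgt (rightKernel ω f) g 2 (𝒢.muS μ) := by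
  simp only [ConvMemL2, FiberSumMemLp, summable_conv_iff_tgt, conv_eq_fiberSum_tgt ω f g]

end Kernel

section Measurability

variable [StandardBorelSpace G]

variable (𝒢) in
theorem measurableSet_src_eq_tgt : MeasurableSet {p : G × G | 𝒢.src p.1 = 𝒢.tgt p.2} :=
  measurableSet_eq_fun (𝒢.measurable_src.comp measurable_fst)
    (𝒢.measurable_tgt.comp measurable_snd)

theorem measurable_mulExt : Measurable 𝒢.mulExt := by
  classical
  exact Measurable.dite (s := {p : G × G | 𝒢.src p.1 = 𝒢.tgt p.2}) 𝒢.measurable_mul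
    (measurable_fst.comp measurable_subtype_coe) 𝒢.measurableSet_src_eq_tgt

theorem Cocycle.measurable_zeroExt (ω : 𝒢.Cocycle) : Measurable ω.zeroExt := by
  classical
  exact Measurable.dite (s := {p : G × G | 𝒢.src p.1 = 𝒢.tgt p.2}) ω.measurable_toFun
    measurable_const 𝒢.measurableSet_src_eq_tgt

theorem measurable_leftKernel (ω : 𝒢.Cocycle) {f : G → ℂ} (hf : Measurable f) :
    Measurable (Function.uncurry (leftKernel ω f)) := by
  have h : Measurable fun p : G × G => 𝒢.mulExt (p.1, 𝒢.inv p.2) :=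
    measurable_mulExt.comp (measurable_fst.prodMk (𝒢.measurable_inv.comp measurable_snd))
  exact (ω.measurable_zeroExt.comp (h.prodMk measurable_snd)).mul (hf.comp h)

theorem measurable_rightKernel (ω : 𝒢.Cocycle) {f : G → ℂ} (hf : Measurable f) :
    Measurable (Function.uncurry (rightKernel ω f)) := by
  have h : Measurable fun p : G × G => 𝒢.mulExt (𝒢.inv p.2, p.1) :=
    measurable_mulExt.comp ((𝒢.measurable_inv.comp measurable_snd).prodMk measurable_fst)
  exact (ω.measurable_zeroExt.comp (measurable_snd.prodMk h)).mul (hf.comp h)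

end Measurability

end DiscreteBorelGroupoid

section FiberSumGraph

variable {X 𝕜 : Type*} [RCLike 𝕜] {σ : X → X} {k : X → X → 𝕜} {D : Set X} {τ : X → X}

theorem fiberSummable_of_graph (hsupp : ∀ x b, σ b = σ x → k x b ≠ 0 → x ∈ D ∧ τ x = b) (g : X → 𝕜)
    (x : X) : FiberSummable σ k g x := by
  refine summable_of_hasFiniteSupport (Set.Subsingleton.finite fun b hb b' hb' => Subtype.ext ?_)
  rw [← (hsupp x b b.2 (left_ne_zero_of_mul hb)).2,
    (hsupp x b' b'.2 (left_ne_zero_of_mul hb')).2]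

theorem fiberSum_eq_indicator_of_graph (hσ : ∀ x ∈ D, σ (τ x) = σ x)
    (hsupp : ∀ x b, σ b = σ x → k x b ≠ 0 → x ∈ D ∧ τ x = b) (g : X → 𝕜) :
    fiberSum σ k g = D.indicator fun x => k x (τ x) * g (τ x) := by
  ext x
  by_cases hx : x ∈ D
  · rw [indicator_of_mem hx]
    refine tsum_eq_single (⟨τ x, hσ x hx⟩ : {b // σ b = σ x}) fun b hb => ?_
    by_contra h
    exact hb (Subtype.ext (hsupp x b b.2 (left_ne_zero_of_mul h)).2.symm)
  · rw [indicator_of_notMem hx]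
    refine (tsum_congr fun b => ?_).trans tsum_zero
    by_contra h
    exact hx (hsupp x b b.2 (left_ne_zero_of_mul h)).1

variable [MeasurableSpace X] {m : Measure X} {p : ℝ≥0∞}

theorem memLp_comp_restrict_of_measure_preimage_le {E : Type*} [NormedAddCommGroup E]
    (hτ : Measurable τ) {C : ℝ≥0}
    (hC : ∀ S, MeasurableSet S → m (D ∩ τ ⁻¹' S) ≤ C * m S) {g : X → E} (hg : MemLp g p m) :
    MemLp (g ∘ τ) p (m.restrict D) := by
  have hmap : (m.restrict D).map τ ≤ C • m := Measure.le_intro fun S hS _ => by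
    rw [Measure.map_apply hτ hS, Measure.restrict_apply (hτ hS), inter_comm]
    exact hC S hS
  exact ((hg.smul_measure ENNReal.coe_ne_top).mono_measure hmap).comp_of_map hτ.aemeasurable

theorem fiberSumMemLp_of_graph (hD : MeasurableSet D) (hτ : Measurable τ)
    (hk : Measurable (Function.uncurry k)) {M : ℝ} (hM : ∀ x b, ‖k x b‖ ≤ M)
    (hσ : ∀ x ∈ D, σ (τ x) = σ x) (hsupp : ∀ x b, σ b = σ x → k x b ≠ 0 → x ∈ D ∧ τ x = b)
    {C : ℝ≥0} (hC : ∀ S, MeasurableSet S → m (D ∩ τ ⁻¹' S) ≤ C * m S) {g : X → 𝕜}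
    (hg : MemLp g p m) : FiberSumMemLp σ k g p m := by
  refine ⟨.of_forall (fiberSummable_of_graph hsupp g), ?_⟩
  have hgτ := memLp_comp_restrict_of_measure_preimage_le hτ hC hg
  rw [fiberSum_eq_indicator_of_graph hσ hsupp, memLp_indicator_iff_restrict hD]
  refine hgτ.of_le_mul (c := M) ?_ (.of_forall fun x => ?_)
  · exact (hk.comp (measurable_id.prodMk hτ)).aestronglyMeasurable.mul hgτ.1
  · rw [norm_mul]
    exact mul_le_mul_of_nonneg_right (hM x _) (norm_nonneg _)

end FiberSumGraph

theorem exists_measurableSet_restrict_le_smul {Y : Type*} [MeasurableSpace Y] {ν μ : Measure Y}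
    [SigmaFinite ν] [SigmaFinite μ] (h : ν ≪ μ) :
    ∃ F : ℕ → Set Y, (∀ j, MeasurableSet (F j)) ∧ (∀ j, ν.restrict (F j) ≤ (j : ℝ≥0) • μ) ∧
      ∀ᵐ y ∂μ, ∃ j, y ∈ F j := by
  have hF : ∀ j : ℕ, MeasurableSet {y | ν.rnDeriv μ y ≤ j} := fun j =>
    measurableSet_le (Measure.measurable_rnDeriv ν μ) measurable_const
  refine ⟨fun j => {y | ν.rnDeriv μ y ≤ j}, hF, fun j => Measure.le_intro fun S hS _ => ?_, ?_⟩
  · rw [Measure.restrict_apply hS, ← Measure.setLIntegral_rnDeriv h, Measure.smul_apply]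
    calc ∫⁻ y in S ∩ {y | ν.rnDeriv μ y ≤ j}, ν.rnDeriv μ y ∂μ
        ≤ ∫⁻ _ in S ∩ {y | ν.rnDeriv μ y ≤ j}, j ∂μ :=
          setLIntegral_mono measurable_const fun y hy => hy.2
      _ = j * μ (S ∩ {y | ν.rnDeriv μ y ≤ j}) := setLIntegral_const _ _
      _ ≤ j * μ S := by gcongr; exact inter_subset_left
      _ = (j : ℝ≥0) • μ S := by rw [ENNReal.smul_def, smul_eq_mul, ENNReal.coe_natCast]
  · filter_upwards [Measure.rnDeriv_lt_top ν μ] with y hy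
    obtain ⟨j, hj⟩ := ENNReal.exists_nat_gt hy.ne
    exact ⟨j, hj.le⟩

namespace DiscreteBorelGroupoid

variable {G : Type*} [MeasurableSpace G] {𝒢 : DiscreteBorelGroupoid G} {μ : Measure G}

section Division

variable (𝒢) in
/-- `τ` recovers `e` from the product `a e` with `a ∈ A`; if the target map is injective on `A`, it
is the map `x ↦ a⁻¹ x` where `a ∈ A` has the target of `x`. -/
def IsLeftDiv (A : Set G) (τ : G → G) : Prop :=
  ∀ a ∈ A, ∀ e, 𝒢.src a = 𝒢.tgt e → τ (𝒢.mul a e) = e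

variable (𝒢) in
/-- `τ` recovers `e` from the product `e b` with `b ∈ B`; if the source map is injective on `B`, it
is the map `x ↦ x b⁻¹` where `b ∈ B` has the source of `x`. -/
def IsRightDiv (B : Set G) (τ : G → G) : Prop :=
  ∀ b ∈ B, ∀ e, 𝒢.src e = 𝒢.tgt b → τ (𝒢.mul e b) = e

variable {A B E : Set G} {τ : G → G}

theorem IsLeftDiv.setMul_eq (hτ : 𝒢.IsLeftDiv A τ) :
    𝒢.setMul A E = 𝒢.tgt ⁻¹' (𝒢.tgt '' A) ∩ τ ⁻¹' E := by
  ext x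
  constructor
  · rintro ⟨a, ha, e, he, hae, rfl⟩
    exact ⟨⟨a, ha, (𝒢.tgt_mul _ _ hae).symm⟩, by rwa [mem_preimage, hτ a ha e hae]⟩
  · rintro ⟨⟨a, ha, hax⟩, hx⟩
    have hτx := hτ a ha _ (tgt_inv_mul hax).symm
    rw [𝒢.mul_inv_cancel_left hax] at hτx
    exact ⟨a, ha, _, hτx ▸ hx, (tgt_inv_mul hax).symm, 𝒢.mul_inv_cancel_left hax⟩

theorem IsRightDiv.setMul_eq (hτ : 𝒢.IsRightDiv B τ) :
    𝒢.setMul E B = 𝒢.src ⁻¹' (𝒢.src '' B) ∩ τ ⁻¹' E := by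
  ext x
  constructor
  · rintro ⟨e, he, b, hb, heb, rfl⟩
    exact ⟨⟨b, hb, (𝒢.src_mul _ _ heb).symm⟩, by rwa [mem_preimage, hτ b hb e heb]⟩
  · rintro ⟨⟨b, hb, hbx⟩, hx⟩
    have hτx := hτ b hb _ (src_mul_inv hbx)
    rw [𝒢.inv_mul_cancel_right hbx] at hτx
    exact ⟨_, hτx ▸ hx, b, hb, src_mul_inv hbx, 𝒢.inv_mul_cancel_right hbx⟩

theorem IsLeftDiv.src_apply (hτ : 𝒢.IsLeftDiv A τ) {x : G}
    (hx : x ∈ 𝒢.tgt ⁻¹' (𝒢.tgt '' A)) : 𝒢.src (τ x) = 𝒢.src x := by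
  obtain ⟨a, ha, hax⟩ := hx
  rw [← 𝒢.mul_inv_cancel_left hax, hτ a ha _ (tgt_inv_mul hax).symm,
    𝒢.src_mul _ _ (tgt_inv_mul hax).symm]

theorem IsRightDiv.tgt_apply (hτ : 𝒢.IsRightDiv B τ) {x : G}
    (hx : x ∈ 𝒢.src ⁻¹' (𝒢.src '' B)) : 𝒢.tgt (τ x) = 𝒢.tgt x := by
  obtain ⟨b, hb, hbx⟩ := hx
  rw [← 𝒢.inv_mul_cancel_right hbx, hτ b hb _ (src_mul_inv hbx),
    𝒢.tgt_mul _ _ (src_mul_inv hbx)]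

variable [StandardBorelSpace G]

theorem IsBorelBisection.measurableSet_src_image (hA : 𝒢.IsBorelBisection A) :
    MeasurableSet (𝒢.src '' A) :=
  hA.measurableSet.image_of_measurable_injOn 𝒢.measurable_src hA.injOn_src

theorem IsBorelBisection.measurableSet_tgt_image (hA : 𝒢.IsBorelBisection A) :
    MeasurableSet (𝒢.tgt '' A) :=
  hA.measurableSet.image_of_measurable_injOn 𝒢.measurable_tgt hA.injOn_tgt

theorem IsBorelBisection.exists_measurable_isLeftDiv (hA : 𝒢.IsBorelBisection A) :
    ∃ τ : G → G, Measurable τ ∧ 𝒢.IsLeftDiv A τ := by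
  rcases isEmpty_or_nonempty G with _ | _
  · exact ⟨id, measurable_id, fun a => isEmptyElim a⟩
  obtain ⟨c, hc, hcA⟩ := exists_measurable_leftInvOn 𝒢.measurable_tgt hA.measurableSet hA.injOn_tgt
  refine ⟨fun x => 𝒢.mulExt (𝒢.inv (c (𝒢.tgt x)), x), measurable_mulExt.comp
    ((𝒢.measurable_inv.comp (hc.comp 𝒢.measurable_tgt)).prodMk measurable_id), ?_⟩
  intro a ha e hae
  beta_reduce
  rw [𝒢.tgt_mul _ _ hae, hcA ha, mulExt_of_src_eq (by rw [𝒢.src_inv, 𝒢.tgt_mul _ _ hae]),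
    𝒢.inv_mul_cancel_left hae]

theorem IsBorelBisection.exists_measurable_isRightDiv (hB : 𝒢.IsBorelBisection B) :
    ∃ τ : G → G, Measurable τ ∧ 𝒢.IsRightDiv B τ := by
  rcases isEmpty_or_nonempty G with _ | _
  · exact ⟨id, measurable_id, fun b => isEmptyElim b⟩
  obtain ⟨c, hc, hcB⟩ := exists_measurable_leftInvOn 𝒢.measurable_src hB.measurableSet hB.injOn_src
  refine ⟨fun x => 𝒢.mulExt (x, 𝒢.inv (c (𝒢.src x))), measurable_mulExt.comp
    (measurable_id.prodMk (𝒢.measurable_inv.comp (hc.comp 𝒢.measurable_src))), ?_⟩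
  intro b hb e heb
  beta_reduce
  rw [𝒢.src_mul _ _ heb, hcB hb, mulExt_of_src_eq (by rw [𝒢.tgt_inv, 𝒢.src_mul _ _ heb]),
    𝒢.mul_inv_cancel_right heb]

theorem IsBorelBisection.measurableSet_setMul (hB : 𝒢.IsBorelBisection B) (hE : MeasurableSet E) :
    MeasurableSet (𝒢.setMul E B) := by
  obtain ⟨τ, hτ, hτB⟩ := hB.exists_measurable_isRightDiv
  rw [hτB.setMul_eq]
  exact (𝒢.measurable_src hB.measurableSet_src_image).inter (hτ hE)

theorem IsBorelBisection.muS_setMul_le [SFinite μ] (hA : 𝒢.IsBorelBisection A)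
    (hE : MeasurableSet E) : 𝒢.muS μ (𝒢.setMul A E) ≤ 𝒢.muS μ E := by
  obtain ⟨τ, hτ, hτA⟩ := hA.exists_measurable_isLeftDiv
  have hAE : MeasurableSet (𝒢.setMul A E) := by
    rw [hτA.setMul_eq]
    exact (𝒢.measurable_tgt hA.measurableSet_tgt_image).inter (hτ hE)
  refine fiberCountMeasure_le_of_mapsTo_of_injOn 𝒢.measurable_src 𝒢.countable_src_fiber
    𝒢.measurable_src 𝒢.countable_src_fiber hAE hE (τ := τ) ?_ ?_ ?_
  · rintro _ ⟨a, ha, e, he, hae, rfl⟩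
    rwa [hτA a ha e hae]
  · rintro _ ⟨a, ha, e, -, hae, rfl⟩ _ ⟨a', ha', e', -, hae', rfl⟩ heq
    rw [hτA a ha e hae, hτA a' ha' e' hae'] at heq
    rw [heq] at hae ⊢
    rw [hA.injOn_src ha ha' (hae.trans hae'.symm)]
  · rintro _ ⟨a, ha, e, -, hae, rfl⟩
    rw [hτA a ha e hae, 𝒢.src_mul _ _ hae]

end Division

section BoundedTranslation

variable (𝒢) in
/-- The condition on a set `B` under which right multiplication by `B` acts boundedly on
`L²(𝒢, μ_s)`: the measure `μ_s(E · B)` is bounded by a constant multiple of `μ_s(E)`. For the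
operator `ρ_A^ω` it is imposed on `B = A⁻¹`. -/
def HasBoundedRightTranslation (μ : Measure G) (B : Set G) : Prop :=
  ∃ C : ℝ≥0, ∀ E, MeasurableSet E → 𝒢.muS μ (𝒢.setMul E B) ≤ C * 𝒢.muS μ E

theorem HasBoundedRightTranslation.mono {B B' : Set G}
    (hB : 𝒢.HasBoundedRightTranslation μ B) (h : B' ⊆ B) : 𝒢.HasBoundedRightTranslation μ B' := by
  obtain ⟨C, hC⟩ := hB
  exact ⟨C, fun E hE => (measure_mono (setMul_mono Subset.rfl h)).trans (hC E hE)⟩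

variable [StandardBorelSpace G] {B : Set G} {c : G → G}

theorem IsBorelBisection.count_setMul_inter_src_fiber_le (hB : 𝒢.IsBorelBisection B)
    (hcB : LeftInvOn c 𝒢.src B) {E : Set G} (hE : MeasurableSet E) (y : G) :
    Measure.count (𝒢.setMul E B ∩ 𝒢.src ⁻¹' {y}) ≤ (𝒢.src '' B).indicator
      (fun y => (Measure.count (E ∩ 𝒢.src ⁻¹' {𝒢.tgt (c y)}) : ℝ≥0∞)) y := by
  obtain ⟨τ, -, hτB⟩ := hB.exists_measurable_isRightDiv
  have hfiber : ∀ y, MeasurableSet (𝒢.src ⁻¹' {y}) := fun y =>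
    𝒢.measurable_src (measurableSet_singleton y)
  by_cases hy : y ∈ 𝒢.src '' B
  · rw [indicator_of_mem hy]
    refine count_le_count_of_mapsTo_of_injOn ((hB.measurableSet_setMul hE).inter (hfiber y))
      (hE.inter (hfiber _)) (τ := τ) ?_ ?_
    · rintro _ ⟨⟨e, he, b, hb, heb, rfl⟩, rfl⟩
      rw [hτB b hb e heb, 𝒢.src_mul _ _ heb, hcB hb]
      exact ⟨he, heb⟩
    · rintro _ ⟨⟨e, -, b, hb, heb, rfl⟩, hy₁⟩ _ ⟨⟨e', -, b', hb', heb', rfl⟩, hy₂⟩ heq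
      rw [hτB b hb e heb, hτB b' hb' e' heb'] at heq
      rw [mem_preimage, 𝒢.src_mul _ _ heb] at hy₁
      rw [mem_preimage, 𝒢.src_mul _ _ heb'] at hy₂
      rw [heq, hB.injOn_src hb hb' (hy₁.trans hy₂.symm)]
  · have hempty : 𝒢.setMul E B ∩ 𝒢.src ⁻¹' {y} = ∅ := by
      refine eq_empty_of_forall_notMem ?_
      rintro _ ⟨⟨e, -, b, hb, heb, rfl⟩, rfl⟩
      exact hy ⟨b, hb, (𝒢.src_mul _ _ heb).symm⟩
    rw [hempty, measure_empty]
    exact zero_le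

theorem IsBorelBisection.muS_setMul_le_of_map_le [SFinite μ] (hB : 𝒢.IsBorelBisection B)
    (hc : Measurable c) (hcB : LeftInvOn c 𝒢.src B) {C : ℝ≥0}
    (hC : (μ.restrict (𝒢.src '' B)).map (𝒢.tgt ∘ c) ≤ C • μ) {E : Set G} (hE : MeasurableSet E) :
    𝒢.muS μ (𝒢.setMul E B) ≤ C * 𝒢.muS μ E := by
  let N : G → ℝ≥0∞ := fun y => Measure.count (E ∩ 𝒢.src ⁻¹' {y})
  have hN : AEMeasurable N ((μ.restrict (𝒢.src '' B)).map (𝒢.tgt ∘ c)) :=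
    ((aemeasurable_count_inter_fiber 𝒢.measurable_src 𝒢.countable_src_fiber hE).smul_measure
      C).mono_measure hC
  calc 𝒢.muS μ (𝒢.setMul E B)
      = ∫⁻ y, Measure.count (𝒢.setMul E B ∩ 𝒢.src ⁻¹' {y}) ∂μ :=
        fiberCountMeasure_apply 𝒢.measurable_src 𝒢.countable_src_fiber (hB.measurableSet_setMul hE)
    _ ≤ ∫⁻ y, (𝒢.src '' B).indicator (fun y => N (𝒢.tgt (c y))) y ∂μ :=
        lintegral_mono fun y => hB.count_setMul_inter_src_fiber_le hcB hE y
    _ = ∫⁻ y, N y ∂(μ.restrict (𝒢.src '' B)).map (𝒢.tgt ∘ c) := by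
        rw [lintegral_indicator hB.measurableSet_src_image,
          lintegral_map' hN (𝒢.measurable_tgt.comp hc).aemeasurable]
        rfl
    _ ≤ ∫⁻ y, N y ∂(C • μ) := lintegral_mono' hC le_rfl
    _ = C * 𝒢.muS μ E := by
        rw [lintegral_smul_measure, ENNReal.smul_def, smul_eq_mul]
        exact congrArg _
          (fiberCountMeasure_apply 𝒢.measurable_src 𝒢.countable_src_fiber hE).symm

theorem IsMeasured.map_tgt_comp_absolutelyContinuous (hμ : 𝒢.IsMeasured μ)
    (hB : 𝒢.IsBorelBisection B) (hc : Measurable c) (hcB : LeftInvOn c 𝒢.src B) :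
    (μ.restrict (𝒢.src '' B)).map (𝒢.tgt ∘ c) ≪ μ := by
  have := hμ.isProbabilityMeasure
  have htc : Measurable (𝒢.tgt ∘ c) := 𝒢.measurable_tgt.comp hc
  refine Measure.AbsolutelyContinuous.mk fun N hN hNnull => ?_
  have hsub : (𝒢.tgt ∘ c) ⁻¹' N ∩ 𝒢.src '' B ⊆ 𝒢.src '' (B ∩ 𝒢.tgt ⁻¹' N) := by
    rintro _ ⟨hy, b, hb, rfl⟩
    rw [mem_preimage, Function.comp_apply, hcB hb] at hy
    exact ⟨b, ⟨hb, hy⟩, rfl⟩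
  have hnull : 𝒢.muS μ (𝒢.tgt ⁻¹' N) = 0 := by
    refine measure_eq_zero_iff_ae_notMem.2 (hμ.ae_muS_iff_tgt.2 ?_)
    filter_upwards [measure_eq_zero_iff_ae_notMem.1 hNnull] with y hy x hx hxN
    exact hy (hx ▸ hxN)
  rw [Measure.map_apply htc hN, Measure.restrict_apply (htc hN)]
  refine measure_mono_null hsub ?_
  rw [← (hB.mono inter_subset_left (hB.measurableSet.inter (𝒢.measurable_tgt hN))).muS_eq]
  exact measure_mono_null inter_subset_right hnull

theorem IsMeasured.exists_bounded_cover_of_isBorelBisection (hμ : 𝒢.IsMeasured μ)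
    (hB : 𝒢.IsBorelBisection B) : ∃ D : ℕ → Set G, (∀ j, 𝒢.IsBorelBisection (D j)) ∧
      (∀ j, 𝒢.HasBoundedRightTranslation μ (D j)) ∧
      ∀ᵐ x ∂(𝒢.muS μ), x ∈ B → ∃ j, x ∈ D j := by
  have := hμ.isProbabilityMeasure
  rcases isEmpty_or_nonempty G with _ | _
  · exact ⟨fun _ => B, fun _ => hB, fun _ => ⟨0, fun E _ => by simp [eq_empty_of_isEmpty]⟩,
      .of_forall fun x => isEmptyElim x⟩
  obtain ⟨c, hc, hcB⟩ := exists_measurable_leftInvOn 𝒢.measurable_src hB.measurableSet hB.injOn_src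
  have htc : Measurable (𝒢.tgt ∘ c) := 𝒢.measurable_tgt.comp hc
  obtain ⟨F, hF, hFle, hFcov⟩ := exists_measurableSet_restrict_le_smul
    (hμ.map_tgt_comp_absolutelyContinuous hB hc hcB)
  have hD : ∀ j, 𝒢.IsBorelBisection (B ∩ 𝒢.tgt ⁻¹' F j) := fun j =>
    hB.mono inter_subset_left (hB.measurableSet.inter (𝒢.measurable_tgt (hF j)))
  refine ⟨fun j => B ∩ 𝒢.tgt ⁻¹' F j, hD, fun j => ⟨j, fun E hE => ?_⟩, ?_⟩
  · refine (hD j).muS_setMul_le_of_map_le hc (hcB.mono inter_subset_left) (le_trans ?_ (hFle j)) hE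
    rw [Measure.restrict_map htc (hF j), Measure.restrict_restrict (htc (hF j))]
    refine Measure.map_mono (Measure.restrict_mono_set _ ?_) htc
    rintro _ ⟨b, ⟨hb, hbF⟩, rfl⟩
    exact ⟨by rwa [mem_preimage, Function.comp_apply, hcB hb], b, hb, rfl⟩
  · filter_upwards [hμ.ae_muS_iff_tgt.2 (hFcov.mono fun y hy x hx => hx ▸ hy :
      ∀ᵐ y ∂μ, ∀ x, 𝒢.tgt x = y → ∃ j, 𝒢.tgt x ∈ F j)] with x ⟨j, hj⟩ hx
    exact ⟨j, hx, hj⟩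

theorem IsMeasured.exists_bounded_bisection_cover (hμ : 𝒢.IsMeasured μ) :
    ∃ B : ℕ → Set G, (∀ n, 𝒢.IsBorelBisection (B n)) ∧
      (∀ n, 𝒢.HasBoundedRightTranslation μ (B n)) ∧ ∀ᵐ x ∂(𝒢.muS μ), ∃ n, x ∈ B n := by
  obtain ⟨B, hB, hcov⟩ := hμ.exists_bisection_cover
  choose D hD hbdd hDcov using fun n => hμ.exists_bounded_cover_of_isBorelBisection (hB n)
  refine ⟨fun n => D n.unpair.1 n.unpair.2, fun n => hD _ _, fun n => hbdd _ _, ?_⟩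
  filter_upwards [hcov, ae_all_iff.2 hDcov] with x ⟨n, hn⟩ hx
  obtain ⟨j, hj⟩ := hx n hn
  exact ⟨Nat.pair n j, by simpa using hj⟩

end BoundedTranslation

section IndicatorConv

variable (ω : 𝒢.Cocycle) {A B : Set G}

theorem Cocycle.norm_zeroExt_le (p : G × G) : ‖ω.zeroExt p‖ ≤ 1 := by
  rw [zeroExt]
  split_ifs
  · exact (Circle.norm_coe _).le
  · simp

theorem norm_leftKernel_indicator_le (x b : G) : ‖leftKernel ω (A.indicator 1) x b‖ ≤ 1 := by
  rw [leftKernel, norm_mul]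
  exact mul_le_one₀ (ω.norm_zeroExt_le _) (norm_nonneg _)
    ((norm_indicator_le_norm_self _ _).trans norm_one.le)

theorem norm_rightKernel_indicator_le (x b : G) : ‖rightKernel ω (A.indicator 1) x b‖ ≤ 1 := by
  rw [rightKernel, norm_mul]
  exact mul_le_one₀ (ω.norm_zeroExt_le _) (norm_nonneg _)
    ((norm_indicator_le_norm_self _ _).trans norm_one.le)

variable [StandardBorelSpace G] {g : G → ℂ}

theorem IsBorelBisection.convMemL2_indicator_left [SFinite μ] (hA : 𝒢.IsBorelBisection A)
    (hg : MemLp g 2 (𝒢.muS μ)) : ConvMemL2 μ ω (A.indicator 1) g := by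
  obtain ⟨τ, hτ, hτA⟩ := hA.exists_measurable_isLeftDiv
  refine (convMemL2_iff_src ω _ g).2 (fiberSumMemLp_of_graph (C := 1)
    (𝒢.measurable_tgt hA.measurableSet_tgt_image) hτ
    (measurable_leftKernel ω (measurable_one.indicator hA.measurableSet))
    (norm_leftKernel_indicator_le ω) (fun x hx => hτA.src_apply hx) ?_ ?_ hg)
  · intro x b hbx hne
    rw [leftKernel_of_src_eq ω _ hbx] at hne
    have hmem : 𝒢.mul x (𝒢.inv b) ∈ A := mem_of_indicator_ne_zero (right_ne_zero_of_mul hne)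
    have hτx := hτA _ hmem b (src_mul_inv hbx)
    rw [𝒢.inv_mul_cancel_right hbx] at hτx
    exact ⟨⟨_, hmem, 𝒢.tgt_mul _ _ (by rw [𝒢.tgt_inv, hbx])⟩, hτx⟩
  · intro S hS
    rw [← hτA.setMul_eq, ENNReal.coe_one, one_mul]
    exact hA.muS_setMul_le hS

theorem IsBorelBisection.convMemL2_indicator_right (hB : 𝒢.IsBorelBisection B)
    (hbdd : 𝒢.HasBoundedRightTranslation μ B) (hg : MemLp g 2 (𝒢.muS μ)) :
    ConvMemL2 μ ω g (B.indicator 1) := by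
  obtain ⟨τ, hτ, hτB⟩ := hB.exists_measurable_isRightDiv
  obtain ⟨C, hC⟩ := hbdd
  refine (convMemL2_iff_tgt ω _ g).2 (fiberSumMemLp_of_graph (C := C)
    (𝒢.measurable_src hB.measurableSet_src_image) hτ
    (measurable_rightKernel ω (measurable_one.indicator hB.measurableSet))
    (norm_rightKernel_indicator_le ω) (fun x hx => hτB.tgt_apply hx) ?_ ?_ hg)
  · intro x a hax hne
    rw [rightKernel_of_tgt_eq ω _ hax] at hne
    have hmem : 𝒢.mul (𝒢.inv a) x ∈ B := mem_of_indicator_ne_zero (right_ne_zero_of_mul hne)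
    have hτx := hτB _ hmem a (tgt_inv_mul hax).symm
    rw [𝒢.mul_inv_cancel_left hax] at hτx
    exact ⟨⟨_, hmem, 𝒢.src_mul _ _ (by rw [𝒢.src_inv, hax])⟩, hτx⟩
  · intro S hS
    rw [← hτB.setMul_eq]
    exact hC S hS

end IndicatorConv

end DiscreteBorelGroupoid

theorem centralizer_eq_and_eq_of_subset {M : Type*} [Mul M] {S L R : Set M} (hSL : S ⊆ L)
    (hRL : R ⊆ Set.centralizer L) (hSR : Set.centralizer S ⊆ R) :
    Set.centralizer S = R ∧ Set.centralizer L = R :=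
  ⟨hSR.antisymm (hRL.trans (Set.centralizer_subset hSL)),
    ((Set.centralizer_subset hSL).trans hSR).antisymm hRL⟩

namespace DiscreteBorelGroupoid

variable {G : Type*} [MeasurableSpace G] {𝒢 : DiscreteBorelGroupoid G} {μ : Measure G}

section FiberAE

variable [StandardBorelSpace G]

theorem fiberAE_src [SFinite μ] : FiberAE 𝒢.src (𝒢.muS μ) := fun P h => by
  rw [ae_muS_iff_src] at h ⊢
  filter_upwards [h] with y hy x hx b hb using hy b (hb.trans hx)

theorem IsMeasured.fiberAE_tgt (hμ : 𝒢.IsMeasured μ) : FiberAE 𝒢.tgt (𝒢.muS μ) := fun P h => by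
  rw [hμ.ae_muS_iff_tgt] at h ⊢
  filter_upwards [h] with y hy x hx b hb using hy b (hb.trans hx)

theorem IsMeasured.ae_factorizations (hμ : 𝒢.IsMeasured μ) {f f' g g' : G → ℂ}
    (hf : f =ᵐ[𝒢.muS μ] f') (hg : g =ᵐ[𝒢.muS μ] g') :
    ∀ᵐ x ∂(𝒢.muS μ), ∀ p : 𝒢.factorizations x, f p.1.1 = f' p.1.1 ∧ g p.1.2 = g' p.1.2 := by
  have := hμ.isProbabilityMeasure
  filter_upwards [hμ.fiberAE_tgt hf, fiberAE_src hg] with x hx hx' p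
  exact ⟨hx _ (𝒢.factorizationsEquivTgt x p).2, hx' _ (𝒢.factorizationsEquivSrc x p).2⟩

theorem IsMeasured.conv_ae_eq (hμ : 𝒢.IsMeasured μ) (ω : 𝒢.Cocycle) {f f' g g' : G → ℂ}
    (hf : f =ᵐ[𝒢.muS μ] f') (hg : g =ᵐ[𝒢.muS μ] g') :
    conv ω f g =ᵐ[𝒢.muS μ] conv ω f' g' := by
  filter_upwards [hμ.ae_factorizations hf hg] with x hx
  exact tsum_congr fun p => by rw [(hx p).1, (hx p).2]

theorem IsMeasured.convMemL2_congr (hμ : 𝒢.IsMeasured μ) {ω : 𝒢.Cocycle} {f f' g g' : G → ℂ}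
    (hf : f =ᵐ[𝒢.muS μ] f') (hg : g =ᵐ[𝒢.muS μ] g') (h : ConvMemL2 μ ω f g) :
    ConvMemL2 μ ω f' g' := by
  refine ⟨?_, h.2.ae_eq (hμ.conv_ae_eq ω hf hg)⟩
  filter_upwards [h.1, hμ.ae_factorizations hf hg] with x hx hx'
  exact hx.congr fun p => by rw [(hx' p).1, (hx' p).2]

end FiberAE

section ConvolutionOperators

variable [StandardBorelSpace G] (ω : 𝒢.Cocycle) {f h : G → ℂ} {T S : 𝒢.L2 μ →L[ℂ] 𝒢.L2 μ}

theorem existsUnique_conv_left [SFinite μ] (hf : ∀ g : 𝒢.L2 μ, ConvMemL2 μ ω f g) :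
    ∃! T : 𝒢.L2 μ →L[ℂ] 𝒢.L2 μ, ∀ g, T g =ᵐ[𝒢.muS μ] conv ω f g := by
  simp only [conv_eq_fiberSum_src]
  exact fiberAE_src.existsUnique_continuousLinearMap fun g => (convMemL2_iff_src ω f g).1 (hf g)

theorem IsMeasured.existsUnique_conv_right (hμ : 𝒢.IsMeasured μ)
    (hf : ∀ g : 𝒢.L2 μ, ConvMemL2 μ ω g f) :
    ∃! T : 𝒢.L2 μ →L[ℂ] 𝒢.L2 μ, ∀ g, T g =ᵐ[𝒢.muS μ] conv ω g f := by
  simp only [conv_eq_fiberSum_tgt]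
  exact hμ.fiberAE_tgt.existsUnique_continuousLinearMap fun g =>
    (convMemL2_iff_tgt ω f g).1 (hf g)

variable {B : ℕ → Set G}

theorem conv_left_of_bisection_cover [SFinite μ] (hf : Measurable f)
    (hB : ∀ n, 𝒢.IsBorelBisection (B n)) (hcov : ∀ᵐ x ∂(𝒢.muS μ), ∃ n, x ∈ B n)
    (hT : ∀ n (E : Set G) (hE : MeasurableSet E) (hfin : 𝒢.muS μ E ≠ ∞), E ⊆ B n →
      T (indicatorConstLp 2 hE hfin 1) =ᵐ[𝒢.muS μ] conv ω f (E.indicator 1)) (g : 𝒢.L2 μ) :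
    ConvMemL2 μ ω f g ∧ T g =ᵐ[𝒢.muS μ] conv ω f g := by
  simp only [convMemL2_iff_src, conv_eq_fiberSum_src] at hT ⊢
  have hcover : IsFiberSumOnCover 𝒢.src (leftKernel ω f) T B :=
    ⟨fun n => (hB n).measurableSet, fun n => (hB n).injOn_src, hcov, hT⟩
  have hk := measurable_leftKernel ω hf
  have hTg := hcover.apply_ae_eq_fiberSum fiberAE_src ENNReal.ofNat_ne_top 𝒢.measurable_src hk g
  exact ⟨⟨hcover.ae_fiberSummable fiberAE_src ENNReal.ofNat_ne_top 𝒢.measurable_src hk g,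
    (Lp.memLp (T g)).ae_eq hTg⟩, hTg⟩

theorem IsMeasured.conv_right_of_bisection_cover (hμ : 𝒢.IsMeasured μ) (hf : Measurable f)
    (hB : ∀ n, 𝒢.IsBorelBisection (B n)) (hcov : ∀ᵐ x ∂(𝒢.muS μ), ∃ n, x ∈ B n)
    (hT : ∀ n (E : Set G) (hE : MeasurableSet E) (hfin : 𝒢.muS μ E ≠ ∞), E ⊆ B n →
      T (indicatorConstLp 2 hE hfin 1) =ᵐ[𝒢.muS μ] conv ω (E.indicator 1) f) (g : 𝒢.L2 μ) :
    ConvMemL2 μ ω g f ∧ T g =ᵐ[𝒢.muS μ] conv ω g f := by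
  simp only [convMemL2_iff_tgt, conv_eq_fiberSum_tgt] at hT ⊢
  have hcover : IsFiberSumOnCover 𝒢.tgt (rightKernel ω f) T B :=
    ⟨fun n => (hB n).measurableSet, fun n => (hB n).injOn_tgt, hcov, hT⟩
  have hk := measurable_rightKernel ω hf
  have hTg := hcover.apply_ae_eq_fiberSum hμ.fiberAE_tgt ENNReal.ofNat_ne_top 𝒢.measurable_tgt hk g
  exact ⟨⟨hcover.ae_fiberSummable hμ.fiberAE_tgt ENNReal.ofNat_ne_top 𝒢.measurable_tgt hk g,
    (Lp.memLp (T g)).ae_eq hTg⟩, hTg⟩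

theorem IsMeasured.commute_of_conv_left_of_conv_right (hμ : 𝒢.IsMeasured μ)
    (hT : ∀ g, T g =ᵐ[𝒢.muS μ] conv ω f g) (hS : ∀ g, S g =ᵐ[𝒢.muS μ] conv ω g h) :
    Commute T S := by
  obtain ⟨B, hB, hcov⟩ := hμ.exists_bisection_cover
  refine Lp_continuousLinearMap_ext_of_cover ENNReal.ofNat_ne_top
    (fun n => (hB n).measurableSet) hcov fun n E hE hfin hsub => Lp.ext ?_
  have hEB := (hB n).mono hsub hE
  have hind : indicatorConstLp 2 hE hfin (1 : ℂ) =ᵐ[𝒢.muS μ] E.indicator 1 := indicatorConstLp_coeFn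
  have hSE := (hS _).trans (hμ.conv_ae_eq ω hind EventuallyEq.rfl)
  have hTE := (hT _).trans (hμ.conv_ae_eq ω EventuallyEq.rfl hind)
  calc T (S (indicatorConstLp 2 hE hfin 1))
      =ᵐ[𝒢.muS μ] conv ω f (conv ω (E.indicator 1) h) :=
        (hT _).trans (hμ.conv_ae_eq ω EventuallyEq.rfl hSE)
    _ = conv ω (conv ω f (E.indicator 1)) h :=
        conv_conv_indicator_assoc ω hEB.injOn_src hEB.injOn_tgt f h
    _ =ᵐ[𝒢.muS μ] S (T (indicatorConstLp 2 hE hfin 1)) :=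
        ((hS _).trans (hμ.conv_ae_eq ω hTE EventuallyEq.rfl)).symm

end ConvolutionOperators

section Translations

variable [StandardBorelSpace G] {ω : 𝒢.Cocycle} {A : Set G} {T : 𝒢.L2 μ →L[ℂ] 𝒢.L2 μ}

theorem IsMeasured.isLeftTranslation_iff (hμ : 𝒢.IsMeasured μ) (hA : 𝒢.IsBorelBisection A) :
    IsLeftTranslation μ ω A T ↔ ∀ g, T g =ᵐ[𝒢.muS μ] conv ω (A.indicator 1) g := by
  have := hμ.isProbabilityMeasure
  have hiff : IsLeftTranslation μ ω A T ↔ ∀ (E : Set G) hE hfin,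
      T (indicatorConstLp 2 hE hfin 1) =ᵐ[𝒢.muS μ] conv ω (A.indicator 1) (E.indicator 1) :=
    forall₃_congr fun E _ _ => eventually_congr <| .of_forall fun x =>
      eq_conv_indicator_indicator_iff ω (.inl hA.injOn_tgt)
  rw [hiff]
  refine ⟨fun hT g => ?_, fun hT E hE hfin =>
    (hT _).trans (hμ.conv_ae_eq ω EventuallyEq.rfl indicatorConstLp_coeFn)⟩
  obtain ⟨B, hB, hcov⟩ := hμ.exists_bisection_cover
  exact (conv_left_of_bisection_cover ω (measurable_one.indicator hA.measurableSet) hB hcov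
    (fun _ E hE hfin _ => hT E hE hfin) g).2

theorem IsMeasured.isRightTranslation_conj_iff (hμ : 𝒢.IsMeasured μ)
    (hA : 𝒢.IsBorelBisection A) :
    IsRightTranslation μ ω.conj A T ↔
      ∀ g, T g =ᵐ[𝒢.muS μ] conv ω g ((𝒢.setInv A).indicator 1) := by
  have hiff : IsRightTranslation μ ω.conj A T ↔ ∀ (E : Set G) hE hfin,
      T (indicatorConstLp 2 hE hfin 1) =ᵐ[𝒢.muS μ]
        conv ω (E.indicator 1) ((𝒢.setInv A).indicator 1) :=
    forall₃_congr fun E _ _ => eventually_congr <| .of_forall fun x => by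
      rw [← eq_conv_indicator_indicator_iff ω (.inr hA.setInv.injOn_src)]
      simp only [← Cocycle.coe_conj, Cocycle.conj_conj]
      exact and_congr_left' ⟨fun h e he b hb => h b hb e he, fun h b hb e he => h e he b hb⟩
  rw [hiff]
  refine ⟨fun hT g => ?_, fun hT E hE hfin =>
    (hT _).trans (hμ.conv_ae_eq ω indicatorConstLp_coeFn EventuallyEq.rfl)⟩
  obtain ⟨B, hB, hcov⟩ := hμ.exists_bisection_cover
  exact (hμ.conv_right_of_bisection_cover ω (measurable_one.indicator hA.setInv.measurableSet)
    hB hcov (fun _ E hE hfin _ => hT E hE hfin) g).2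

theorem IsMeasured.existsUnique_isLeftTranslation (hμ : 𝒢.IsMeasured μ) (ω : 𝒢.Cocycle)
    (hA : 𝒢.IsBorelBisection A) : ∃! T, IsLeftTranslation μ ω A T := by
  have := hμ.isProbabilityMeasure
  simp only [hμ.isLeftTranslation_iff hA]
  exact existsUnique_conv_left ω fun g => hA.convMemL2_indicator_left ω (Lp.memLp g)

theorem IsMeasured.existsUnique_isRightTranslation (hμ : 𝒢.IsMeasured μ) (ω : 𝒢.Cocycle)
    (hA : 𝒢.IsBorelBisection A) (hbdd : 𝒢.HasBoundedRightTranslation μ (𝒢.setInv A)) :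
    ∃! T, IsRightTranslation μ ω.conj A T := by
  simp only [hμ.isRightTranslation_conj_iff hA]
  exact hμ.existsUnique_conv_right ω fun g =>
    hA.setInv.convMemL2_indicator_right ω hbdd (Lp.memLp g)

theorem IsMeasured.mem_leftConvolvers_of_isLeftTranslation (hμ : 𝒢.IsMeasured μ)
    (hA : 𝒢.IsBorelBisection A) (hT : IsLeftTranslation μ ω A T) : T ∈ leftConvolvers μ ω := by
  have := hμ.isProbabilityMeasure
  have hind : A.indicator 1 =ᵐ[𝒢.muS μ] indicatorConstLp 2 hA.measurableSet hA.muS_ne_top (1 : ℂ) :=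
    indicatorConstLp_coeFn.symm
  refine ⟨indicatorConstLp 2 hA.measurableSet hA.muS_ne_top 1, fun g => ?_, fun g => ?_⟩
  · exact hμ.convMemL2_congr hind EventuallyEq.rfl (hA.convMemL2_indicator_left ω (Lp.memLp g))
  · exact ((hμ.isLeftTranslation_iff hA).1 hT g).trans (hμ.conv_ae_eq ω hind EventuallyEq.rfl)

theorem IsMeasured.mem_rightConvolvers_of_isRightTranslation (hμ : 𝒢.IsMeasured μ)
    (hA : 𝒢.IsBorelBisection A) (hT : IsRightTranslation μ ω.conj A T) :
    T ∈ rightConvolvers μ ω.conj := by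
  have := hμ.isProbabilityMeasure
  obtain ⟨B, hB, hcov⟩ := hμ.exists_bisection_cover
  have hA' := hA.setInv
  have hind : (𝒢.setInv A).indicator 1 =ᵐ[𝒢.muS μ]
      indicatorConstLp 2 hA'.measurableSet hA'.muS_ne_top (1 : ℂ) := indicatorConstLp_coeFn.symm
  rw [hμ.isRightTranslation_conj_iff hA] at hT
  have hconv := hμ.conv_right_of_bisection_cover ω (measurable_one.indicator hA'.measurableSet)
    hB hcov fun n E hE hfin _ =>
      (hT _).trans (hμ.conv_ae_eq ω indicatorConstLp_coeFn EventuallyEq.rfl)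
  refine ⟨indicatorConstLp 2 hA'.measurableSet hA'.muS_ne_top 1, fun g => ?_, fun g => ?_⟩ <;>
    rw [ω.conj_conj]
  · exact hμ.convMemL2_congr EventuallyEq.rfl hind (hconv g).1
  · exact (hT g).trans (hμ.conv_ae_eq ω EventuallyEq.rfl hind)

end Translations

section Commutants

variable [StandardBorelSpace G]

variable (𝒢 μ) in
/-- The indicator function of the units, as a vector of `L²(𝒢, μ_s)`. It is the unit for
convolution; an operator commuting with the translations is determined by its value here. -/
noncomputable def unitVector [IsFiniteMeasure μ] : 𝒢.L2 μ :=
  indicatorConstLp 2 𝒢.measurableSet_units isBorelBisection_units.muS_ne_top 1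

theorem unitVector_ae_eq [IsFiniteMeasure μ] :
    𝒢.unitVector μ =ᵐ[𝒢.muS μ] 𝒢.units.indicator 1 :=
  indicatorConstLp_coeFn

variable {E : Set G} {T S : 𝒢.L2 μ →L[ℂ] 𝒢.L2 μ} (ω : 𝒢.Cocycle)

theorem IsMeasured.conv_unitVector_ae_eq [IsFiniteMeasure μ] (hμ : 𝒢.IsMeasured μ) (f : G → ℂ) :
    conv ω f (𝒢.unitVector μ) =ᵐ[𝒢.muS μ] f := by
  have h := hμ.conv_ae_eq ω (EventuallyEq.refl _ f) unitVector_ae_eq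
  rwa [conv_indicator_units] at h

theorem IsMeasured.unitVector_conv_ae_eq [IsFiniteMeasure μ] (hμ : 𝒢.IsMeasured μ) (f : G → ℂ) :
    conv ω (𝒢.unitVector μ) f =ᵐ[𝒢.muS μ] f := by
  have h := hμ.conv_ae_eq ω unitVector_ae_eq (EventuallyEq.refl _ f)
  rwa [indicator_units_conv] at h

theorem IsMeasured.centralizer_leftTranslations_subset (hμ : 𝒢.IsMeasured μ) :
    Set.centralizer {T | ∃ A, 𝒢.IsBorelBisection A ∧ IsLeftTranslation μ ω A T} ⊆
      rightConvolvers μ ω.conj := by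
  intro T hT
  have := hμ.isProbabilityMeasure
  obtain ⟨B, hB, hcov⟩ := hμ.exists_bisection_cover
  have key := hμ.conv_right_of_bisection_cover ω (T := T) (f := T (𝒢.unitVector μ))
    (Lp.stronglyMeasurable _).measurable hB hcov fun n E hE hfin hsub => ?_
  · refine ⟨T (𝒢.unitVector μ), fun g => ?_, fun g => ?_⟩ <;> rw [ω.conj_conj]
    exacts [(key g).1, (key g).2]
  have hEB := (hB n).mono hsub hE
  obtain ⟨S, hS, -⟩ := hμ.existsUnique_isLeftTranslation ω hEB
  have hSconv := (hμ.isLeftTranslation_iff hEB).1 hS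
  have hS_unit : S (𝒢.unitVector μ) = indicatorConstLp 2 hE hfin 1 := Lp.ext <|
    (hSconv _).trans ((hμ.conv_unitVector_ae_eq ω _).trans indicatorConstLp_coeFn.symm)
  have hcomm : S (T (𝒢.unitVector μ)) = T (S (𝒢.unitVector μ)) :=
    DFunLike.congr_fun (Set.mem_centralizer_iff.1 hT S ⟨E, hEB, hS⟩) _
  rw [← hS_unit, ← hcomm]
  exact hSconv _

theorem IsMeasured.centralizer_rightTranslations_subset (hμ : 𝒢.IsMeasured μ) :
    Set.centralizer {T | ∃ A, 𝒢.IsBorelBisection A ∧ IsRightTranslation μ ω.conj A T} ⊆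
      leftConvolvers μ ω := by
  intro T hT
  have := hμ.isProbabilityMeasure
  obtain ⟨B, hB, hbdd, hcov⟩ := hμ.exists_bounded_bisection_cover
  have key := conv_left_of_bisection_cover ω (T := T) (f := T (𝒢.unitVector μ))
    (Lp.stronglyMeasurable _).measurable hB hcov fun n E hE hfin hsub => ?_
  · exact ⟨T (𝒢.unitVector μ), fun g => (key g).1, fun g => (key g).2⟩
  have hEB := (hB n).mono hsub hE
  obtain ⟨S, hS, -⟩ := hμ.existsUnique_isRightTranslation ω hEB.setInv
    (by rw [setInv_setInv]; exact (hbdd n).mono hsub)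
  have hSconv := (hμ.isRightTranslation_conj_iff hEB.setInv).1 hS
  rw [setInv_setInv] at hSconv
  have hS_unit : S (𝒢.unitVector μ) = indicatorConstLp 2 hE hfin 1 := Lp.ext <|
    (hSconv _).trans ((hμ.unitVector_conv_ae_eq ω _).trans indicatorConstLp_coeFn.symm)
  have hcomm : S (T (𝒢.unitVector μ)) = T (S (𝒢.unitVector μ)) :=
    DFunLike.congr_fun (Set.mem_centralizer_iff.1 hT S ⟨_, hEB.setInv, hS⟩) _
  rw [← hS_unit, ← hcomm]
  exact hSconv _

theorem IsMeasured.leftConvolvers_subset_centralizer (hμ : 𝒢.IsMeasured μ) :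
    leftConvolvers μ ω ⊆ Set.centralizer (rightConvolvers μ ω.conj) := by
  rintro T ⟨f, -, hT⟩ S ⟨h, -, hS⟩
  refine (hμ.commute_of_conv_left_of_conv_right ω hT (h := h) fun g => ?_).eq.symm
  simpa only [ω.conj_conj] using hS g

theorem IsMeasured.rightConvolvers_subset_centralizer (hμ : 𝒢.IsMeasured μ) :
    rightConvolvers μ ω.conj ⊆ Set.centralizer (leftConvolvers μ ω) :=
  Set.subset_centralizer_centralizer.trans
    (Set.centralizer_subset (hμ.leftConvolvers_subset_centralizer ω))

theorem IsMeasured.centralizer_leftTranslations (hμ : 𝒢.IsMeasured μ) :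
    Set.centralizer {T | ∃ A, 𝒢.IsBorelBisection A ∧ IsLeftTranslation μ ω A T} =
        rightConvolvers μ ω.conj ∧
      Set.centralizer (leftConvolvers μ ω) = rightConvolvers μ ω.conj :=
  centralizer_eq_and_eq_of_subset
    (fun _ ⟨_, hA, hT⟩ => hμ.mem_leftConvolvers_of_isLeftTranslation hA hT)
    (hμ.rightConvolvers_subset_centralizer ω) (hμ.centralizer_leftTranslations_subset ω)

theorem IsMeasured.centralizer_rightTranslations (hμ : 𝒢.IsMeasured μ) :
    Set.centralizer {T | ∃ A, 𝒢.IsBorelBisection A ∧ IsRightTranslation μ ω.conj A T} =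
        leftConvolvers μ ω ∧
      Set.centralizer (rightConvolvers μ ω.conj) = leftConvolvers μ ω :=
  centralizer_eq_and_eq_of_subset
    (fun _ ⟨_, hA, hT⟩ => hμ.mem_rightConvolvers_of_isRightTranslation hA hT)
    (hμ.leftConvolvers_subset_centralizer ω) (hμ.centralizer_rightTranslations_subset ω)

end Commutants

end DiscreteBorelGroupoid

open DiscreteBorelGroupoid in
/-- The first four conjuncts say that the operators in the definitions of the four algebras exist
(and are bounded and unique); the last four are the equalities of the algebras. -/
theorem mainTheorem11 {G : Type*} [MeasurableSpace G] [StandardBorelSpace G]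
    (𝒢 : DiscreteBorelGroupoid G) (μ : Measure G) (hμ : 𝒢.IsMeasured μ) (ω : 𝒢.Cocycle) :
    (∀ A, 𝒢.IsBorelBisection A → ∃! T, IsLeftTranslation μ ω A T) ∧
    (∀ A, 𝒢.IsBorelBisection A →
      (∃ c : ℝ≥0, ∀ E, MeasurableSet E →
        𝒢.muS μ (𝒢.setMul E (𝒢.setInv A)) ≤ c * 𝒢.muS μ E) →
      ∃! T, IsRightTranslation μ ω.conj A T) ∧
    (∀ f, IsLeftConvolver μ ω f → ∃! T, IsLeftConv μ ω f T) ∧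
    (∀ f, IsRightConvolver μ ω.conj f → ∃! T, IsRightConv μ ω.conj f T) ∧
    leftVN μ ω = leftConvolvers μ ω ∧
    leftConvolvers μ ω = Set.centralizer (rightVN μ ω.conj) ∧
    rightVN μ ω.conj = rightConvolvers μ ω.conj ∧
    rightConvolvers μ ω.conj = Set.centralizer (leftVN μ ω) := by
  obtain ⟨hl, hl'⟩ := hμ.centralizer_leftTranslations ω
  obtain ⟨hr, hr'⟩ := hμ.centralizer_rightTranslations ω
  have := hμ.isProbabilityMeasure
  refine ⟨fun A hA => hμ.existsUnique_isLeftTranslation ω hA,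
    fun A hA hbdd => hμ.existsUnique_isRightTranslation ω hA hbdd,
    fun f hf => existsUnique_conv_left ω hf, fun f hf => hμ.existsUnique_conv_right _ hf,
    ?_, ?_, ?_, ?_⟩
  · rw [leftVN, hl, hr']
  · rw [rightVN, hr, hl', hr']
  · rw [rightVN, hr, hl']
  · rw [leftVN, hl, hr', hl']
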